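/- Setting. For $\alpha>1$, an $\alpha$-HST of depth $h$ is a finite rooted tree $T$ all of whose leaves have depth $h$ and in which every edge from a vertex of depth $i$ to a child has length $\alpha^{h-1-i}$. An HST is an $\alpha$-HST for some $\alpha>1$. A one-shot instance of DSMS (distributed serving with mobile servers) on $T$ consists of $k\ge 1$ servers initially located at distinct leaves $v_0^1,\dots,v_0^k$ of $T$, and of a finite set of requests, each invoked at a leaf of $T$, all at time $0$ (a leaf may invoke several requests and may also host a server). Each server $z$ has a dummy request $r_0^z$ at $v_0^z$. A solution consists of $k$ schedules, the $z$-th starting with $r_0^z$, such that every request occurs exactly once in exactly one schedule; the predecessor of a request is the request immediately before it in its schedule. Communication is asynchronous: the latency of each transmission of a message over an edge is positive and at most the length of the edge, and otherwise arbitrary. The communication cost is the sum of the latencies of all transmissions. The protocol GNN. Every vertex $v$ keeps a set $\mathrm{links}(v)$. Initially, if the subtree of $v$ contains servers, $v$ points to its children whose subtrees contain servers (and to itself if $v$ is a leaf hosting a server); otherwise $v$ points to its parent. When a leaf $u$ invokes a request $r$: if $\mathrm{links}(u)=\{u\}$, then $r$ is scheduled immediately after the last request invoked by $u$ (the dummy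 request, if there is no other); if $\mathrm{links}(u)=\{v\}$ with $v\ne u$, then $u$ sends the find-predecessor message of $r$ to $v$ and sets $\mathrm{links}(u):=\{u\}$. When $w$ receives the message of $r$ from $v$, it atomically chooses $z\in\mathrm{links}(w)$, an arbitrary child if there is a child in $\mathrm{links}(w)$ and the only element otherwise, and replaces $z$ by $v$ in $\mathrm{links}(w)$; if $z\neq w$ it forwards the message to $z$, and if $z=w$ then $r$ is scheduled immediately after the last request invoked by $w$. The order of the invocations at time $0$, the order in which simultaneous arrivals are processed and the choices among several children are arbitrary. Offline protocols. An offline protocol knows the whole instance; for every behaviour of the latencies it produces a solution and, for every request $r$, sends a separate message from the leaf of $r$ to the leaf of the predecessor of $r$, along any route in $T$, and possibly further messages. Its cost is the worst case (supremum), over all latencies, of its communication cost. The cost of an optimal offline protocol is the infimum of the costs of all offline protocols. Theorem. For every one-shot instance of DSMS on an HST, GNN with asynchronous communication solves the instance optimally: every execution of GNN ends after finitely many steps; in every complete execution all requests are scheduled and the resulting schedules form a solution; and the total communication cost of every complete execution is at most the cost of an optimal offline protocol. -/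

import Mathlib

/-! ### Hierarchically well-separated trees -/

/-- An `α`-HST of depth `depth` with vertex set `V`, `α > 1`: a rooted tree given by its parent map
(the root is its own parent by convention), in which the root has height `depth`, every child has
height one less than its parent, and all leaves have height `0`.  The edge between a vertex of
height `i` and its parent has length `α ^ i`; so the children of the root are at distance
`α ^ (depth - 1)` from it, and every child of the root spans an `α`-HST of depth `depth - 1`. -/
structure HST (V : Type*) where
  /-- the separation parameter -/
  α : ℝ
  one_lt_α : 1 < α
  depth : ℕ
  root : V
  parent : V → V
  height : V → ℕ
  parent_root : parent root = root
  height_root : height root = depth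
  height_parent : ∀ v, v ≠ root → height (parent v) = height v + 1
  height_leaf : ∀ v, (∀ c, ¬ (c ≠ root ∧ parent c = v)) → height v = 0

namespace HST

variable {V : Type*} (T : HST V)

/-- `c` is a child of `v`. -/
def IsChild (c v : V) : Prop := c ≠ T.root ∧ T.parent c = v

/-- A leaf is a vertex without children. -/
def IsLeaf (v : V) : Prop := ∀ c, ¬ T.IsChild c v

/-- `u` is a vertex of the subtree rooted at `v`. -/
def InSubtree (v u : V) : Prop := ∃ n : ℕ, T.parent^[n] u = v

/-- The underlying undirected tree. -/
def graph : SimpleGraph V := SimpleGraph.fromRel (fun u v => T.parent u = v)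

/-- The length of the edge between the adjacent vertices `u` and `v`
(the lower one determines it). -/
noncomputable def weight (u v : V) : ℝ := T.α ^ min (T.height u) (T.height v)

end HST

/-! ### One-shot instances of distributed serving with mobile servers -/

/-- A one-shot instance on an HST: `k ≥ 1` servers at distinct leaves, and requests (indexed by `R`)
at leaves, all of them invoked at time `0`.  A leaf may host a server and invoke any number of
requests. -/
structure DSMS (V R : Type*) where
  T : HST V
  k : ℕ
  one_le_k : 1 ≤ k
  server : Fin k → V
  server_injective : Function.Injective server
  server_leaf : ∀ z, T.IsLeaf (server z)
  node : R → V
  node_leaf : ∀ r, T.IsLeaf (node r)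

namespace DSMS

variable {V R : Type*} (I : DSMS V R)

/-- All requests, including the dummy request `Sum.inl z` of every server `z`. -/
abbrev Req : Type _ := Fin I.k ⊕ R

/-- The leaf of a request; the dummy request of `z` is at the initial position of `z`. -/
def loc : I.Req → V := Sum.elim I.server I.node

/-- The predecessor assignment `pred` describes a solution: there are `k` schedules, the one of
server `z` starting with the dummy request of `z`, such that every request occurs exactly once in
exactly one of the schedules, and `pred r` is the request immediately before `r`. -/
def IsSolution (pred : R → I.Req) : Prop :=
  ∃ queue : Fin I.k → List R,
    (∀ z, (queue z).Nodup) ∧ (∀ r, ∃! z, r ∈ queue z) ∧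
    ∀ r, ∃ z, [pred r, Sum.inr r] <:+: (Sum.inl z : I.Req) :: (queue z).map Sum.inr

/-! ### The protocol GNN under asynchronous communication -/

/-- What has become of a request: it has not been invoked yet; or its find-predecessor message is in
transit over the edge from `src` to `dst`, which it entered at time `sent`; or it has been scheduled
immediately after the request `pred`. -/
inductive Status
  | waiting : Status
  | transit (src dst : V) (sent : ℝ) : Status
  | scheduled (pred : I.Req) : Status

/-- A global state of an execution of GNN. -/
structure State where
  /-- the current time -/
  now : ℝ
  /-- the neighbours (possibly itself) that a vertex points to -/
  links : V → Set V
  /-- the last request that has been invoked at a vertex -/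
  last : V → Option I.Req
  status : R → I.Status
  /-- the sum of the latencies of all transmissions so far -/
  cost : ℝ

open Classical in
/-- The initial state: a vertex with servers in its subtree points to the children towards these
servers (a leaf hosting a server points to itself), any other vertex points to its parent. -/
noncomputable def init : I.State where
  now := 0
  links v := {x | (I.T.IsChild x v ∧ ∃ z, I.T.InSubtree x (I.server z)) ∨
    (x = v ∧ ∃ z, I.server z = v) ∨
    (x = I.T.parent v ∧ ¬ ∃ z, I.T.InSubtree v (I.server z))}
  last v := if h : ∃ z, I.server z = v then some (Sum.inl h.choose) else none
  status _ := Status.waiting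
  cost := 0

/-- At time `t` and in state `s`, the message of some request can arrive: time does not run
backwards, all requests have been invoked (at time `0`), and no message in transit is overdue, i.e.
the latency of every transmission is at most the length of the edge. -/
def Admissible (s : I.State) (t : ℝ) : Prop :=
  s.now ≤ t ∧ (∀ r, s.status r ≠ Status.waiting) ∧
  ∀ r u v τ, s.status r = Status.transit u v τ → t ≤ τ + I.T.weight u v

/-- When `w` receives a message, `z` is a legal choice of the link along which `w` forwards it:
some link to a child if there is one, and otherwise any (in fact the only) link of `w`. -/
def LegalChoice (s : I.State) (w z : V) : Prop :=
  z ∈ s.links w ∧ ((∃ c ∈ s.links w, I.T.IsChild c w) → I.T.IsChild z w)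

section GNN

variable [DecidableEq V] [DecidableEq R]

/-- The atomic steps of GNN.  The order of the invocations, the latencies (positive and at most the
length of the edge), the order in which simultaneous arrivals are processed, and the choices among
several downward links are all arbitrary. -/
inductive Step : I.State → I.State → Prop
  /-- A leaf with a self-loop invokes `r`. -/
  | invokeLocal (s : I.State) (r : R) (q : I.Req)
      (hr : s.status r = Status.waiting)
      (hl : s.links (I.node r) = {I.node r})
      (hq : s.last (I.node r) = some q) :
      Step s
        { s with
          last := Function.update s.last (I.node r) (some (Sum.inr r))
          status := Function.update s.status r (Status.scheduled q) }
  /-- A leaf without a self-loop invokes `r` and sends a find-predecessor message. -/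
  | invokeSend (s : I.State) (r : R) (v : V)
      (hr : s.status r = Status.waiting)
      (hl : s.links (I.node r) = {v})
      (hv : v ≠ I.node r) :
      Step s
        { s with
          links := Function.update s.links (I.node r) {I.node r}
          last := Function.update s.last (I.node r) (some (Sum.inr r))
          status := Function.update s.status r (Status.transit (I.node r) v s.now) }
  /-- At time `t`, the message of `r` reaches `w` from `v` and is forwarded to `z`. -/
  | forward (s : I.State) (r : R) (v w z : V) (τ t : ℝ)
      (hr : s.status r = Status.transit v w τ)
      (hτ : τ < t) (ht : I.Admissible s t)
      (hz : I.LegalChoice s w z) (hzw : z ≠ w) :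
      Step s
        { s with
          now := t
          links := Function.update s.links w (insert v (s.links w \ {z}))
          status := Function.update s.status r (Status.transit w z t)
          cost := s.cost + (t - τ) }
  /-- At time `t`, the message of `r` reaches `w` from `v`, and `w` points to itself. -/
  | arrive (s : I.State) (r : R) (v w : V) (τ t : ℝ) (q : I.Req)
      (hr : s.status r = Status.transit v w τ)
      (hτ : τ < t) (ht : I.Admissible s t)
      (hz : I.LegalChoice s w w) (hq : s.last w = some q) :
      Step s
        { s with
          now := t
          links := Function.update s.links w (insert v (s.links w \ {w}))
          status := Function.update s.status r (Status.scheduled q)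
          cost := s.cost + (t - τ) }

/-- `s` is the final state of a complete execution: it is reached from the initial state, and no
step is possible any more. -/
def IsFinal (s : I.State) : Prop :=
  Relation.ReflTransGen I.Step I.init s ∧ ∀ s', ¬ I.Step s s'

/-- There is an infinite execution. -/
def HasInfiniteExecution : Prop :=
  ∃ run : ℕ → I.State, run 0 = I.init ∧ ∀ n, I.Step (run n) (run (n + 1))

end GNN

/-! ### Offline protocols -/

/-- The latencies, which no protocol controls: `val r j u v` is the latency of the `j`-th
transmission on behalf of the request `r`, if that transmission goes from `u` to `v`.  It is positive
and at most the length of the edge. -/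
structure Latencies where
  val : R → ℕ → V → V → ℝ
  pos : ∀ r j u v, I.T.graph.Adj u v → 0 < val r j u v
  le_weight : ∀ r j u v, I.T.graph.Adj u v → val r j u v ≤ I.T.weight u v

/-- The result of running an offline protocol: a solution, and for every request `r` the messages
sent to schedule `r`, namely one that travels from the leaf of `r` to the leaf of the predecessor of
`r`, along any route in the tree, and any further transmissions over edges of the tree. -/
structure Outcome where
  pred : R → I.Req
  isSolution : I.IsSolution pred
  route : ∀ r, I.T.graph.Walk (I.node r) (I.loc (pred r))
  extra : R → List I.T.graph.Dart

/-- All transmissions on behalf of the request `r`. -/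
def Outcome.transmissions {I : DSMS V R} (o : I.Outcome) (r : R) : List I.T.graph.Dart :=
  (o.route r).darts ++ o.extra r

/-- The total communication cost of an outcome: the sum of the latencies of all transmissions. -/
noncomputable def Outcome.cost {I : DSMS V R} [Fintype R] (o : I.Outcome) (l : I.Latencies) : ℝ :=
  ∑ r, ∑ j : Fin (o.transmissions r).length,
    l.val r j ((o.transmissions r).get j).fst ((o.transmissions r).get j).snd

/-- An offline protocol knows the instance; its behaviour may depend on the latencies in any way. -/
abbrev OfflineProtocol : Type _ := I.Latencies → I.Outcome

/-- The cost of an offline protocol: the worst case over all latencies. -/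
noncomputable def worstCaseCost [Fintype R] (P : I.OfflineProtocol) : EReal :=
  ⨆ l : I.Latencies, (((P l).cost l : ℝ) : EReal)

/-- The cost of an optimal offline protocol. -/
noncomputable def offlineOptimum [Fintype R] : EReal :=
  ⨅ P : I.OfflineProtocol, I.worstCaseCost P

end DSMS

/-!
GNN terminates, solves the instance and is optimal because of the following facts, all of them about
executions in which every step is a *hop* (`Hop`): some vertex `w` processes a message that comes
from `v` and replaces its link `z` by `v`.  Every edge is pointed along in at most one direction,
and not at all while it carries a message, of which there is at most one (`Wired`).  Hence messages
do not turn back: they ascend, turn once, and descend.  This bounds the number of hops of each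
message (`not_hasInfiniteExecution`), and the message with the earliest deadline can always be delivered
(`IsFinal.exists_scheduled`).

*Cost.*  Call a vertex needy if its subtree contains requests, but no server.  The two sides are
compared with the sum of `2 * α ^ height c` over all needy vertices `c`.

* Offline protocols pay at least this much when the latencies are maximal
  (`sum_needy_le_offlineOptimum`): in any solution, some request below `c` has its predecessor
  outside the subtree of `c`, so its message ascends over the edge above `c`; and a path between
  leaves descends as much as it ascends.
* GNN pays at most this much (`cost_le`).  Its cost is the integral over time of the number of
  messages in transit, so it suffices that after the time `2 * climb i` there are at most as many of
  them as there are needy vertices of height `i` (`card_inTransit_le`).  As all requests are invoked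
  at time `0`, ascending messages leave height `i` by the time `climb i`, and by `2 * climb i` all
  messages that turned below or at this height, or that entered a subtree of this height before
  `climb i`, have arrived.  Therefore a message in transit below height `i` has come down into the
  subtree of a vertex `c` of height `i` after the last ascending message has left it; it is alone
  there, and `c` points to its parent (`Timed`).  The number of messages above height `i` plus the
  number of vertices of height `i` that point to their parents never increases
  (`card_high_add_card_up_le`), and initially it is the number of vertices of height `i` without
  servers below; the vertices without servers and requests below keep their upward links
  (`untouched`), and cancel.

*Solution.*  No request gets two successors (`Queued`), so only cycles of predecessors have to be
excluded.  The key is `History.leadsTo_up`: when a message is sent down or scheduled at a vertex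
`w`, following predecessors from its request leads to a server, or to a request whose message has
left `w` upwards at an earlier time.  Indeed a link to a child `c` is there because of a server or
because a message has come up from `c` before, and the claim for `c` applies.  Climbing to the root,
from which nothing leaves upwards, shows that every request leads back to a server
(`History.leadsToServer`).
-/

/-! ### Ancestors and heights in an HST -/

namespace HST

variable {V : Type*} {T : HST V}

theorem IsChild.height_eq {c v : V} (h : T.IsChild c v) : T.height v = T.height c + 1 := by
  rw [← h.2]; exact T.height_parent c h.1

theorem IsChild.ne {c v : V} (h : T.IsChild c v) : c ≠ v := by
  intro e; have := h.height_eq; rw [e] at this; omega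

theorem IsChild.asymm {c v : V} (h : T.IsChild c v) : ¬ T.IsChild v c := by
  intro h'; have := h.height_eq; have := h'.height_eq; omega

theorem IsChild.unique {c v w : V} (h : T.IsChild c v) (h' : T.IsChild c w) : v = w :=
  h.2.symm.trans h'.2

theorem adj_iff {u v : V} : T.graph.Adj u v ↔ T.IsChild u v ∨ T.IsChild v u := by
  have key : ∀ a b : V, a ≠ b → T.parent a = b → T.IsChild a b := by
    rintro a b hab h
    refine ⟨?_, h⟩
    rintro rfl
    exact hab (T.parent_root ▸ h)
  rw [graph, SimpleGraph.fromRel_adj]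
  constructor
  · rintro ⟨hne, h | h⟩
    · exact Or.inl (key _ _ hne h)
    · exact Or.inr (key _ _ hne.symm h)
  · rintro (h | h)
    · exact ⟨h.ne, Or.inl h.2⟩
    · exact ⟨h.ne.symm, Or.inr h.2⟩

theorem weight_of_isChild {c v : V} (h : T.IsChild c v) : T.weight c v = T.α ^ T.height c := by
  rw [weight, h.height_eq, min_eq_left (Nat.le_succ _)]

theorem weight_comm (u v : V) : T.weight u v = T.weight v u := by
  rw [weight, weight, min_comm]

theorem alpha_pos : 0 < T.α := zero_lt_one.trans T.one_lt_α

theorem weight_pos (u v : V) : 0 < T.weight u v := pow_pos alpha_pos _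

theorem IsLeaf.height_eq {v : V} (h : T.IsLeaf v) : T.height v = 0 := T.height_leaf v h

theorem InSubtree.refl (v : V) : T.InSubtree v v := ⟨0, rfl⟩

theorem InSubtree.trans {a b c : V} (h : T.InSubtree a b) (h' : T.InSubtree b c) :
    T.InSubtree a c := by
  obtain ⟨n, rfl⟩ := h
  obtain ⟨m, rfl⟩ := h'
  exact ⟨n + m, Function.iterate_add_apply _ _ _ _⟩

theorem IsChild.inSubtree {c v : V} (h : T.IsChild c v) : T.InSubtree v c := ⟨1, h.2⟩

theorem inSubtree_cases {v u : V} (h : T.InSubtree v u) : u = v ∨ T.InSubtree v (T.parent u) := by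
  obtain ⟨_ | n, h⟩ := h
  · exact Or.inl h
  · exact Or.inr ⟨n, h⟩

/-- A vertex in the subtree of `v` other than `v` has its parent in that subtree. -/
theorem InSubtree.of_isChild {v c p : V} (h : T.InSubtree v c) (hc : T.IsChild c p) (hne : c ≠ v) :
    T.InSubtree v p :=
  hc.2 ▸ (inSubtree_cases h).resolve_left hne

theorem iterate_parent_root (n : ℕ) : T.parent^[n] T.root = T.root :=
  Function.iterate_fixed T.parent_root n

theorem isChild_parent {v : V} (h : v ≠ T.root) : T.IsChild v (T.parent v) := ⟨h, rfl⟩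

theorem not_isChild_root (v : V) : ¬ T.IsChild T.root v := fun h => h.1 rfl

/-- The height of the `n`-th iterated parent, as long as the root has not been passed. -/
theorem height_iterate (v : V) (n : ℕ) :
    T.parent^[n] v = T.root ∨ T.height (T.parent^[n] v) = T.height v + n := by
  induction n with
  | zero => exact Or.inr rfl
  | succ n ih =>
    rw [Function.iterate_succ_apply']
    by_cases h : T.parent^[n] v = T.root
    · left; rw [h, T.parent_root]
    · right
      rw [T.height_parent _ h, ih.resolve_left h]; omega

theorem InSubtree.height_le {v u : V} (h : T.InSubtree v u) (hu : T.height u ≤ T.depth) :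
    T.height u ≤ T.height v := by
  obtain ⟨n, rfl⟩ := h
  rcases T.height_iterate u n with h | h
  · rwa [h, T.height_root]
  · omega

/-- In the subtree of an inner vertex, everything but the vertex itself is below a child. -/
theorem InSubtree.exists_child {v u : V} (h : T.InSubtree v u) (hne : u ≠ v) :
    ∃ c, T.IsChild c v ∧ T.InSubtree c u := by
  obtain ⟨n, hn⟩ := h
  induction n generalizing u with
  | zero => exact absurd hn hne
  | succ n ih =>
    have hu : u ≠ T.root := by
      rintro rfl
      rw [iterate_parent_root] at hn
      exact hne hn
    by_cases hp : T.parent u = v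
    · exact ⟨u, ⟨hu, hp⟩, InSubtree.refl u⟩
    · obtain ⟨c, hc, hcu⟩ := ih (u := T.parent u) hp hn
      exact ⟨c, hc, hcu.trans (isChild_parent hu).inSubtree⟩

section Fintype

variable [Fintype V]

theorem inSubtree_root (v : V) : T.InSubtree T.root v := by
  by_contra hcon
  have key : ∀ n, T.height (T.parent^[n] v) = T.height v + n := fun n =>
    (T.height_iterate v n).resolve_left fun h => hcon ⟨n, h⟩
  have hinj : Function.Injective fun n : ℕ => T.parent^[n] v := by
    intro a b hab
    have := key a
    have := key b
    simp only at hab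
    rw [hab] at *
    omega
  exact not_injective_infinite_finite _ hinj

theorem height_le_depth (v : V) : T.height v ≤ T.depth := by
  obtain ⟨n, hn⟩ := T.inSubtree_root v
  induction n generalizing v with
  | zero =>
    rw [Function.iterate_zero_apply] at hn
    rw [hn, T.height_root]
  | succ n ih =>
    by_cases h : v = T.root
    · rw [h, T.height_root]
    · have := ih (T.parent v) hn
      rw [T.height_parent v h] at this
      omega

theorem IsChild.height_lt {c v : V} (h : T.IsChild c v) : T.height c < T.depth := by
  have := T.height_le_depth v
  rw [h.height_eq] at this
  omega

theorem InSubtree.le {v u : V} (h : T.InSubtree v u) : T.height u ≤ T.height v :=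
  h.height_le (T.height_le_depth u)

theorem InSubtree.eq_of_height_le {v u : V} (h : T.InSubtree v u)
    (hh : T.height v ≤ T.height u) : u = v := by
  rcases inSubtree_cases h with h1 | h1
  · exact h1
  · by_cases hu : u = T.root
    · obtain ⟨n, hn⟩ := h
      rw [hu] at hn ⊢
      rw [iterate_parent_root] at hn
      exact hn
    · have := h1.le
      rw [T.height_parent u hu] at this
      omega

theorem eq_root_of_height_eq {v : V} (h : T.height v = T.depth) : v = T.root :=
  (T.inSubtree_root v).eq_of_height_le (by rw [T.height_root, h])

/-- Two ancestors of a vertex with the same height coincide. -/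
theorem InSubtree.eq_of_height_eq {a b u : V} (ha : T.InSubtree a u) (hb : T.InSubtree b u)
    (h : T.height a = T.height b) : a = b := by
  obtain ⟨n, hn⟩ := ha
  obtain ⟨m, hm⟩ := hb
  rcases le_total n m with hnm | hnm
  · have : T.InSubtree b a := ⟨m - n, by
      rw [← hn, ← Function.iterate_add_apply, Nat.sub_add_cancel hnm, hm]⟩
    exact this.eq_of_height_le h.ge
  · have : T.InSubtree a b := ⟨n - m, by
      rw [← hm, ← Function.iterate_add_apply, Nat.sub_add_cancel hnm, hn]⟩
    exact (this.eq_of_height_le h.le).symm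

theorem exists_ancestor (u : V) {i : ℕ} (h : T.height u ≤ i) (hi : i ≤ T.depth) :
    ∃ a, T.InSubtree a u ∧ T.height a = i := by
  rcases T.height_iterate u (i - T.height u) with h' | h'
  · by_cases hid : i = T.depth
    · exact ⟨T.root, T.inSubtree_root u, by rw [T.height_root, hid]⟩
    · exfalso
      have key : ∀ n, T.parent^[n] u = T.root → T.depth ≤ T.height u + n := by
        intro n
        induction n with
        | zero => intro hn; rw [Function.iterate_zero_apply] at hn; rw [hn, T.height_root]; omega
        | succ n ih =>
          intro hn
          rcases T.height_iterate u n with h1 | h1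
          · have := ih h1; omega
          · rw [Function.iterate_succ_apply'] at hn
            by_cases hr : T.parent^[n] u = T.root
            · have := ih hr; omega
            · have := T.height_parent _ hr
              rw [hn, T.height_root, h1] at this
              omega
      have := key _ h'
      omega
  · exact ⟨_, ⟨_, rfl⟩, by rw [h']; omega⟩

theorem InSubtree.eq_of_isLeaf {v u : V} (h : T.InSubtree v u) (hv : T.IsLeaf v) : u = v :=
  h.eq_of_height_le (by rw [hv.height_eq]; exact Nat.zero_le _)

end Fintype

variable (T) in
/-- The length of a path from a leaf up to a vertex of height `i`, which is the time that a message
needs for it in the worst case. -/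
noncomputable def climb (i : ℕ) : ℝ := ∑ j ∈ Finset.range i, T.α ^ j

theorem climb_zero : T.climb 0 = 0 := Finset.sum_range_zero _

theorem climb_succ (i : ℕ) : T.climb (i + 1) = T.climb i + T.α ^ i := Finset.sum_range_succ _ _

theorem climb_mono : Monotone T.climb :=
  monotone_nat_of_le_succ fun i => by
    rw [climb_succ]; exact le_add_of_nonneg_right (pow_pos alpha_pos i).le

theorem climb_nonneg (i : ℕ) : 0 ≤ T.climb i := climb_zero (T := T) ▸ climb_mono (Nat.zero_le i)

end HST

/-! ### Steps of GNN as hops of messages -/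

namespace DSMS

variable {V R : Type*} {I : DSMS V R}

/-- The message of `r` is in transit over the edge between `u` and `v`, in either direction. -/
def OnEdge (s : I.State) (r : R) (u v : V) : Prop :=
  ∃ τ, s.status r = Status.transit u v τ ∨ s.status r = Status.transit v u τ

theorem OnEdge.symm {s : I.State} {r : R} {u v : V} (h : OnEdge s r u v) : OnEdge s r v u :=
  let ⟨τ, h⟩ := h; ⟨τ, h.symm⟩

theorem onEdge_of_transit {s : I.State} {r : R} {u v : V} {τ : ℝ}
    (h : s.status r = Status.transit u v τ) : OnEdge s r u v := ⟨τ, Or.inl h⟩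

/-- The common shape of all steps of GNN: `w` processes the message of `r`, which comes from `v`,
by replacing the link `z` of `w` by `v`.  An invocation is a message that comes from `w` itself,
and `z = w` means that `r` is scheduled at `w`. -/
structure Hop [DecidableEq V] [DecidableEq R] (s s' : I.State) (r : R) (v w z : V) : Prop where
  choice : I.LegalChoice s w z
  links : s'.links = Function.update s.links w (insert v (s.links w \ {z}))
  source : (s.status r = Status.waiting ∧ v = w ∧ w = I.node r ∧
      s'.last = Function.update s.last w (some (Sum.inr r)) ∧ s'.now = s.now ∧ s'.cost = s.cost) ∨
    ∃ τ, s.status r = Status.transit v w τ ∧ s'.last = s.last ∧ τ < s'.now ∧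
      I.Admissible s s'.now ∧ s'.cost = s.cost + (s'.now - τ)
  target : (z ≠ w ∧ s'.status = Function.update s.status r (Status.transit w z s'.now)) ∨
    (z = w ∧ ∃ q, s.last w = some q ∧
      s'.status = Function.update s.status r (Status.scheduled q))

section

variable [DecidableEq V] [DecidableEq R]

theorem Step.exists_hop {s s' : I.State} (h : I.Step s s') : ∃ r v w z, Hop s s' r v w z := by
  cases h with
  | invokeLocal r q hr hl hq =>
    refine ⟨r, I.node r, I.node r, I.node r, ⟨⟨hl ▸ rfl, ?_⟩, ?_, Or.inl ⟨hr, rfl, rfl, rfl, rfl, rfl⟩,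
      Or.inr ⟨rfl, q, hq, rfl⟩⟩⟩
    · rintro ⟨c, -, hc⟩
      exact absurd hc (I.node_leaf r c)
    · rw [hl]; simp [← hl]
  | invokeSend r v hr hl hv =>
    refine ⟨r, I.node r, I.node r, v, ⟨⟨hl ▸ rfl, ?_⟩, ?_, Or.inl ⟨hr, rfl, rfl, rfl, rfl, rfl⟩,
      Or.inl ⟨hv, rfl⟩⟩⟩
    · rintro ⟨c, -, hc⟩
      exact absurd hc (I.node_leaf r c)
    · simp [hl]
  | forward r v w z τ t hr hτ ht hz hzw =>
    exact ⟨r, v, w, z, hz, rfl, Or.inr ⟨τ, hr, rfl, hτ, ht, rfl⟩, Or.inl ⟨hzw, rfl⟩⟩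
  | arrive r v w τ t q hr hτ ht hz hq =>
    exact ⟨r, v, w, w, hz, rfl, Or.inr ⟨τ, hr, rfl, hτ, ht, rfl⟩, Or.inr ⟨rfl, q, hq, rfl⟩⟩

/-! ### Links and messages on the edges -/

/-- The state of the edges and of the links in an execution of GNN: an edge is pointed along in at
most one direction, and it is not pointed along while a message is in transit over it, of which
there is at most one. -/
structure Wired (s : I.State) : Prop where
  link_cases : ∀ w x, x ∈ s.links w →
    (x = w ∧ I.T.IsLeaf w) ∨ I.T.IsChild x w ∨ I.T.IsChild w x
  links_nonempty : ∀ w, (s.links w).Nonempty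
  links_leaf : ∀ w, I.T.IsLeaf w → ∃ x, s.links w = {x}
  links_asymm : ∀ x y, x ≠ y → y ∈ s.links x → x ∉ s.links y
  adj : ∀ r u v, OnEdge s r u v → I.T.IsChild u v ∨ I.T.IsChild v u
  not_mem_links : ∀ r u v, OnEdge s r u v → v ∉ s.links u
  onEdge_unique : ∀ r r' u v, OnEdge s r u v → OnEdge s r' u v → r = r'
  last_isSome : ∀ w, w ∈ s.links w → ∃ q, s.last w = some q
  loc_last : ∀ w q, s.last w = some q → I.loc q = w

end

theorem Wired.init [Fintype V] (I : DSMS V R) : Wired I.init := by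
  have hroot : ∃ z, I.T.InSubtree I.T.root (I.server z) :=
    ⟨⟨0, I.one_le_k⟩, I.T.inSubtree_root _⟩
  have key : ∀ w x, x ∈ I.init.links w ↔ (I.T.IsChild x w ∧ ∃ z, I.T.InSubtree x (I.server z)) ∨
    (x = w ∧ ∃ z, I.server z = w) ∨ (I.T.IsChild w x ∧ ¬ ∃ z, I.T.InSubtree w (I.server z)) := by
    intro w x
    change _ ∨ _ ∨ _ ↔ _
    refine or_congr Iff.rfl (or_congr Iff.rfl (and_congr_left fun h => ?_))
    have : w ≠ I.T.root := by rintro rfl; exact h hroot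
    exact ⟨fun e => e ▸ HST.isChild_parent this, fun h => h.2.symm⟩
  have hno : ∀ r u v, ¬ OnEdge I.init r u v := by
    rintro r u v ⟨τ, h | h⟩ <;> cases h
  refine ⟨?_, ?_, ?_, ?_,
    fun r u v h => absurd h (hno r u v), fun r u v h => absurd h (hno r u v), fun r r' u v h => absurd h (hno r u v), ?_, ?_⟩
  · intro w x hx
    rcases (key w x).1 hx with h | h | h
    · exact Or.inr (Or.inl h.1)
    · obtain ⟨rfl, z, rfl⟩ := h
      exact Or.inl ⟨rfl, I.server_leaf z⟩
    · exact Or.inr (Or.inr h.1)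
  · intro w
    by_cases h : ∃ z, I.T.InSubtree w (I.server z)
    · obtain ⟨z, hz⟩ := h
      by_cases hw : I.server z = w
      · exact ⟨w, (key w w).2 (Or.inr (Or.inl ⟨rfl, z, hw⟩))⟩
      · obtain ⟨c, hc, hcz⟩ := hz.exists_child hw
        exact ⟨c, (key w c).2 (Or.inl ⟨hc, z, hcz⟩)⟩
    · have : w ≠ I.T.root := by rintro rfl; exact h hroot
      exact ⟨_, (key w _).2 (Or.inr (Or.inr ⟨HST.isChild_parent this, h⟩))⟩
  · intro w hw
    have hleaf : ∀ z, I.T.InSubtree w (I.server z) ↔ I.server z = w := fun z =>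
      ⟨fun h => h.eq_of_isLeaf hw, fun h => h ▸ HST.InSubtree.refl _⟩
    by_cases h : ∃ z, I.server z = w
    · refine ⟨w, Set.ext fun x => (key w x).trans ⟨?_, fun hx => Or.inr (Or.inl ⟨hx, h⟩)⟩⟩
      rintro (h1 | h1 | h1)
      · exact absurd h1.1 (hw x)
      · exact h1.1
      · simp only [hleaf] at h1
        exact absurd h h1.2
    · have hr : w ≠ I.T.root := by rintro rfl; simp only [hleaf] at hroot; exact h hroot
      refine ⟨I.T.parent w, Set.ext fun x => (key w x).trans ⟨?_, ?_⟩⟩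
      · rintro (h1 | h1 | h1)
        · exact absurd h1.1 (hw x)
        · exact absurd h1.2 h
        · exact h1.1.2.symm
      · rintro rfl
        simp only [hleaf]
        exact Or.inr (Or.inr ⟨HST.isChild_parent hr, h⟩)
  · intro x y hxy hy hx
    rcases (key x y).1 hy with h | h | h
    · rcases (key y x).1 hx with h' | h' | h'
      · exact h.1.asymm h'.1
      · exact hxy h'.1
      · exact h'.2 h.2
    · exact hxy h.1.symm
    · rcases (key y x).1 hx with h' | h' | h'
      · exact h.2 h'.2
      · exact hxy h'.1
      · exact h.1.asymm h'.1
  · intro w hw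
    rcases (key w w).1 hw with h | h | h
    · exact absurd rfl h.1.ne
    · exact ⟨_, dif_pos h.2⟩
    · exact absurd rfl h.1.ne
  · intro w q hq
    simp only [DSMS.init] at hq
    split_ifs at hq with h
    cases hq
    exact h.choose_spec

section

variable [DecidableEq V] [DecidableEq R] {s s' : I.State} {r : R} {v w z : V}

theorem Hop.mem_links (h : Hop s s' r v w z) {x y : V} :
    y ∈ s'.links x ↔ if x = w then y = v ∨ (y ∈ s.links w ∧ y ≠ z) else y ∈ s.links x := by
  rw [h.links, Function.update_apply]
  split_ifs <;> simp [Set.mem_insert_iff]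

theorem Hop.links_of_ne (h : Hop s s' r v w z) {x : V} (hx : x ≠ w) :
    s'.links x = s.links x := by
  rw [h.links, Function.update_of_ne hx]

theorem Hop.status_of_ne (h : Hop s s' r v w z) {r' : R} (hr : r' ≠ r) :
    s'.status r' = s.status r' := by
  rcases h.target with ⟨-, e⟩ | ⟨-, q, -, e⟩ <;> rw [e, Function.update_of_ne hr]

theorem Hop.status_self_of_ne (h : Hop s s' r v w z) (hz : z ≠ w) :
    s'.status r = Status.transit w z s'.now := by
  rcases h.target with ⟨-, e⟩ | ⟨e, -⟩
  · rw [e, Function.update_self]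
  · exact absurd e hz

theorem Hop.status_self_of_eq (h : Hop s s' r v w z) (hz : z = w) :
    ∃ q, s.last w = some q ∧ s'.status r = Status.scheduled q := by
  rcases h.target with ⟨e, -⟩ | ⟨-, q, hq, e⟩
  · exact absurd hz e
  · exact ⟨q, hq, by rw [e, Function.update_self]⟩

theorem Hop.status_ne_waiting (h : Hop s s' r v w z) : s'.status r ≠ Status.waiting := by
  by_cases hz : z = w
  · obtain ⟨q, -, e⟩ := h.status_self_of_eq hz
    rw [e]; exact nofun
  · rw [h.status_self_of_ne hz]; exact nofun

/-- What a message in transit after a hop was before. -/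
theorem Hop.of_transit (h : Hop s s' r v w z) {r' : R} {x y : V} {τ : ℝ}
    (h' : s'.status r' = Status.transit x y τ) :
    (r' ≠ r ∧ s.status r' = Status.transit x y τ) ∨
      (r' = r ∧ z ≠ w ∧ x = w ∧ y = z ∧ τ = s'.now) := by
  by_cases hr : r' = r
  · subst hr
    right
    by_cases hz : z = w
    · obtain ⟨q, -, e⟩ := h.status_self_of_eq hz
      rw [e] at h'; cases h'
    · rw [h.status_self_of_ne hz] at h'
      cases h'
      exact ⟨rfl, hz, rfl, rfl, rfl⟩
  · rw [h.status_of_ne hr] at h'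
    exact Or.inl ⟨hr, h'⟩

theorem Hop.of_onEdge (h : Hop s s' r v w z) {r' : R} {x y : V} (h' : OnEdge s' r' x y) :
    (r' ≠ r ∧ OnEdge s r' x y) ∨
      (r' = r ∧ z ≠ w ∧ ((x = w ∧ y = z) ∨ (x = z ∧ y = w))) := by
  obtain ⟨τ, h' | h'⟩ := h'
  · rcases h.of_transit h' with ⟨h1, h2⟩ | ⟨h1, h2, h3, h4, -⟩
    · exact Or.inl ⟨h1, τ, Or.inl h2⟩
    · exact Or.inr ⟨h1, h2, Or.inl ⟨h3, h4⟩⟩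
  · rcases h.of_transit h' with ⟨h1, h2⟩ | ⟨h1, h2, h3, h4, -⟩
    · exact Or.inl ⟨h1, τ, Or.inr h2⟩
    · exact Or.inr ⟨h1, h2, Or.inr ⟨h4, h3⟩⟩

/-- A message either is just being invoked or comes in over an edge. -/
theorem Hop.source_cases (h : Hop s s' r v w z) :
    (s.status r = Status.waiting ∧ v = w ∧ w = I.node r) ∨ OnEdge s r v w := by
  rcases h.source with h | ⟨τ, h, -⟩
  · exact Or.inl ⟨h.1, h.2.1, h.2.2.1⟩
  · exact Or.inr (onEdge_of_transit h)

theorem Wired.source_adj (hs : Wired s) (h : Hop s s' r v w z) :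
    (v = w ∧ w = I.node r) ∨ I.T.IsChild v w ∨ I.T.IsChild w v :=
  h.source_cases.imp (fun h => h.2) (hs.adj _ _ _)

theorem Wired.target_adj (hs : Wired s) (h : Hop s s' r v w z) :
    (z = w ∧ I.T.IsLeaf w) ∨ I.T.IsChild z w ∨ I.T.IsChild w z :=
  hs.link_cases _ _ h.choice.1

/-- Messages do not turn back. -/
theorem Wired.target_ne (hs : Wired s) (h : Hop s s' r v w z) (hv : v ≠ w) : z ≠ v := by
  rintro rfl
  rcases h.source_cases with h' | h'
  · exact hv h'.2.1
  · exact hs.not_mem_links _ _ _ h'.symm h.choice.1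

/-- Messages do not turn from descending to ascending. -/
theorem Wired.not_up_of_down (hs : Wired s) (h : Hop s s' r v w z) (hv : I.T.IsChild w v) :
    ¬ I.T.IsChild w z := fun hz =>
  hs.target_ne h hv.ne.symm (hz.unique hv)

theorem Wired.hop (hs : Wired s) (h : Hop s s' r v w z) : Wired s' := by
  have hadj := hs.source_adj h
  have hzw := h.choice.1
  refine ⟨?_, ?_, ?_, ?_, ?_, ?_, ?_, ?_, ?_⟩
  · intro x y hy
    rw [h.mem_links] at hy
    split_ifs at hy with hx
    · subst hx
      rcases hy with rfl | ⟨hy, -⟩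
      · rcases hadj with ⟨h1, h2⟩ | h1
        · exact Or.inl ⟨h1, h2 ▸ I.node_leaf r⟩
        · exact Or.inr h1
      · exact hs.link_cases _ _ hy
    · exact hs.link_cases _ _ hy
  · intro x
    by_cases hx : x = w
    · exact ⟨v, by rw [h.mem_links, if_pos hx]; exact Or.inl rfl⟩
    · rw [h.links_of_ne hx]; exact hs.links_nonempty x
  · intro x hl
    by_cases hx : x = w
    · subst hx
      obtain ⟨y, hy⟩ := hs.links_leaf x hl
      rw [hy] at hzw
      refine ⟨v, ?_⟩
      rw [h.links, Function.update_self, hy, Set.mem_singleton_iff.1 hzw]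
      simp
    · rw [h.links_of_ne hx]; exact hs.links_leaf x hl
  · intro x y hxy hy hx
    rw [h.mem_links] at hy hx
    have key : ∀ y, y ≠ w → (y = v ∨ (y ∈ s.links w ∧ y ≠ z)) → w ∉ s.links y := by
      rintro y hyw (rfl | hy)
      · rcases h.source_cases with h' | h'
        · exact absurd h'.2.1 hyw
        · exact hs.not_mem_links _ _ _ h'
      · exact hs.links_asymm _ _ hyw.symm hy.1
    split_ifs at hy hx with h1 h2 h2
    · exact hxy (h1.trans h2.symm)
    · exact key y h2 hy (h1 ▸ hx)
    · exact key x h1 hx (h2 ▸ hy)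
    · exact hs.links_asymm _ _ hxy hy hx
  · intro r' x y h'
    rcases h.of_onEdge h' with ⟨-, h1⟩ | ⟨-, hne, h1⟩
    · exact hs.adj _ _ _ h1
    · have := (hs.target_adj h).resolve_left fun h => hne h.1
      rcases h1 with ⟨rfl, rfl⟩ | ⟨rfl, rfl⟩
      · exact this.symm
      · exact this
  · intro r' x y h' hy
    rw [h.mem_links] at hy
    rcases h.of_onEdge h' with ⟨hne, h1⟩ | ⟨-, hne, h1⟩
    · split_ifs at hy with hx
      · rcases hy with hy | hy
        · subst hx; subst hy
          rcases h.source_cases with h2 | h2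
          · rw [h2.2.1] at h1
            rcases hs.adj _ _ _ h1 with h3 | h3 <;> exact h3.ne rfl
          · exact hne (hs.onEdge_unique _ _ _ _ h1 h2.symm)
        · exact hs.not_mem_links _ _ _ h1 (hx ▸ hy.1)
      · exact hs.not_mem_links _ _ _ h1 hy
    · rcases h1 with ⟨rfl, rfl⟩ | ⟨rfl, rfl⟩
      · rw [if_pos rfl] at hy
        rcases hy with rfl | hy
        · by_cases hv : y = x
          · exact hne hv
          · exact hs.target_ne h hv rfl
        · exact hy.2 rfl
      · rw [if_neg hne] at hy
        exact hs.links_asymm _ _ hne.symm hzw hy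
  · intro r1 r2 x y h1 h2
    rcases h.of_onEdge h1 with ⟨hne1, h1⟩ | ⟨rfl, hne1, h1⟩ <;>
      rcases h.of_onEdge h2 with ⟨hne2, h2⟩ | ⟨rfl, hne2, h2⟩
    · exact hs.onEdge_unique _ _ _ _ h1 h2
    · exfalso
      rcases h2 with ⟨rfl, rfl⟩ | ⟨rfl, rfl⟩
      · exact hs.not_mem_links _ _ _ h1 hzw
      · exact hs.not_mem_links _ _ _ h1.symm hzw
    · exfalso
      rcases h1 with ⟨rfl, rfl⟩ | ⟨rfl, rfl⟩
      · exact hs.not_mem_links _ _ _ h2 hzw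
      · exact hs.not_mem_links _ _ _ h2.symm hzw
    · rfl
  · intro x hx
    rw [h.mem_links] at hx
    rcases h.source with ⟨-, hv, -, hl, -⟩ | ⟨τ, hτ, hl, -⟩
    · rw [hl]
      by_cases hxw : x = w
      · subst hxw; exact ⟨_, Function.update_self ..⟩
      · rw [Function.update_of_ne hxw]
        rw [if_neg hxw] at hx
        exact hs.last_isSome x hx
    · rw [hl]
      refine hs.last_isSome x ?_
      split_ifs at hx with hxw
      · subst hxw
        rcases hx with rfl | hx
        · rcases hs.adj _ _ _ (onEdge_of_transit hτ) with h3 | h3 <;> exact absurd rfl h3.ne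
        · exact hx.1
      · exact hx
  · intro x q hq
    rcases h.source with ⟨-, hv, hw, hl, -⟩ | ⟨τ, hτ, hl, -⟩
    · rw [hl] at hq
      by_cases hxw : x = w
      · subst hxw
        rw [Function.update_self] at hq
        cases hq
        exact hw.symm
      · rw [Function.update_of_ne hxw] at hq
        exact hs.loc_last x q hq
    · rw [hl] at hq
      exact hs.loc_last x q hq

/-- Invariants of the executions of GNN may be proved hop by hop, using `Wired` along the way. -/
theorem Wired.induction [Fintype V] {P : I.State → Prop} (h0 : P I.init)
    (hstep : ∀ s s' r v w z, Wired s → P s → Hop s s' r v w z → P s') {s : I.State}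
    (hs : Relation.ReflTransGen I.Step I.init s) : Wired s ∧ P s := by
  induction hs with
  | refl => exact ⟨Wired.init I, h0⟩
  | tail _ h ih =>
    obtain ⟨r, v, w, z, hh⟩ := h.exists_hop
    exact ⟨ih.1.hop hh, hstep _ _ _ _ _ _ ih.1 ih.2 hh⟩

end

end DSMS

/-! ### When messages ascend and descend -/

namespace DSMS

variable {V R : Type*} {I : DSMS V R}

/-- The message of `r` descends inside the subtree of `c`, so late that it may be in transit after
the time `2 * climb (height c)`, at which all messages that have turned inside this subtree have
arrived. -/
def Late (s : I.State) (c : V) (r : R) : Prop :=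
  ∃ a b τ, s.status r = Status.transit a b τ ∧ I.T.IsChild b a ∧ I.T.InSubtree c a ∧
    2 * I.T.climb (I.T.height c) < τ + I.T.climb (I.T.height a)

/-- The timing of an execution.  All requests are invoked at time `0`, and a message that ascends has
done so from its leaf on, so that it leaves height `i` by the time `climb i`.  A message that is
late in the subtree of `c` has entered the subtree after the last ascending message has left it; so
there is only one, and `c` has pointed to its parent since. -/
structure Timed (s : I.State) : Prop where
  now_nonneg : 0 ≤ s.now
  now_eq_zero : ∀ r, s.status r = Status.waiting → s.now = 0
  sent_le : ∀ r u v τ, s.status r = Status.transit u v τ → τ ≤ s.now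
  now_le : ∀ r u v τ, s.status r = Status.transit u v τ → s.now ≤ τ + I.T.weight u v
  sent_le_climb : ∀ r u v τ, s.status r = Status.transit u v τ → I.T.IsChild u v →
    τ ≤ I.T.climb (I.T.height u)
  late_link : ∀ c r, Late s c r → ∃ p ∈ s.links c, I.T.IsChild c p
  late_unique : ∀ c r r', Late s c r → Late s c r' → r = r'

theorem Timed.init (I : DSMS V R) : Timed I.init := by
  refine ⟨le_rfl, fun _ _ => rfl, nofun, nofun, nofun, ?_, ?_⟩
  · rintro c r ⟨a, b, τ, h, -⟩; cases h
  · rintro c r r' ⟨a, b, τ, h, -⟩; cases h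

section

variable [Fintype V] {s : I.State} {r : R}

theorem Timed.climb_lt_of_late (ht : Timed s) {c : V} (hl : Late s c r) :
    I.T.climb (I.T.height c) < s.now := by
  obtain ⟨a, b, τ, hτ, -, hca, hlt⟩ := hl
  have h1 := ht.sent_le _ _ _ _ hτ
  have h2 : I.T.climb (I.T.height a) ≤ I.T.climb (I.T.height c) := HST.climb_mono hca.le
  linarith

/-- After the time `2 * climb (height c)`, messages inside the subtree of `c` are late. -/
theorem Timed.late_of_admissible (ht : Timed s) (hs : Wired s) {t : ℝ} (hadm : I.Admissible s t)
    {c u x : V} {τ : ℝ} (hlt : 2 * I.T.climb (I.T.height c) < t)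
    (hτ : s.status r = Status.transit u x τ) (hu : I.T.InSubtree c u) (hx : I.T.InSubtree c x) :
    Late s c r := by
  have h1 := hadm.2.2 _ _ _ _ hτ
  rcases hs.adj _ _ _ (onEdge_of_transit hτ) with h2 | h2
  · have h3 := ht.sent_le_climb _ _ _ _ hτ h2
    have h4 : I.T.climb (I.T.height x) ≤ I.T.climb (I.T.height c) := HST.climb_mono hx.le
    rw [HST.weight_of_isChild h2] at h1
    rw [h2.height_eq, HST.climb_succ] at h4
    have := I.T.climb_nonneg (I.T.height c)
    linarith
  · refine ⟨u, x, τ, hτ, h2, hu, ?_⟩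
    rw [HST.weight_comm, HST.weight_of_isChild h2] at h1
    rw [h2.height_eq, HST.climb_succ]
    have := I.T.climb_nonneg (I.T.height x)
    linarith

/-- No message is in transit after the time `2 * climb depth`. -/
theorem Timed.le_of_admissible (ht : Timed s) (hs : Wired s) {t : ℝ} (hadm : I.Admissible s t)
    {u x : V} {τ : ℝ} (hτ : s.status r = Status.transit u x τ) : t ≤ 2 * I.T.climb I.T.depth := by
  by_contra hcon
  rw [not_le, ← I.T.height_root] at hcon
  have h1 := ht.late_of_admissible hs hadm hcon hτ (I.T.inSubtree_root u) (I.T.inSubtree_root x)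
  obtain ⟨p, -, hp⟩ := ht.late_link _ _ h1
  exact I.T.not_isChild_root p hp

end

section

variable [DecidableEq V] [DecidableEq R] {s s' : I.State} {r : R} {v w z : V}

theorem Hop.now_le (h : Hop s s' r v w z) : s.now ≤ s'.now := by
  rcases h.source with ⟨-, -, -, -, h, -⟩ | ⟨τ, -, -, -, h, -⟩
  · exact h.ge
  · exact h.1

theorem Hop.now_eq_of_waiting (h : Hop s s' r v w z) {r' : R} (hr : s.status r' = Status.waiting) :
    s'.now = s.now := by
  rcases h.source with ⟨-, -, -, -, h, -⟩ | ⟨τ, -, -, -, h, -⟩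
  · exact h
  · exact absurd hr (h.2.1 r')

/-- A message that moves up or turns does so before the deadline of the ascending messages. -/
theorem Timed.now_le_climb (ht : Timed s) (hs : Wired s) (h : Hop s s' r v w z)
    (hv : ¬ I.T.IsChild w v) : s'.now ≤ I.T.climb (I.T.height w) := by
  rcases h.source with ⟨hr, -⟩ | ⟨τ, hτ, -, -, hadm, -⟩
  · rw [h.now_eq_of_waiting hr, ht.now_eq_zero r hr]
    exact HST.climb_nonneg _
  · have hvw := (hs.adj _ _ _ (onEdge_of_transit hτ)).resolve_right hv
    have h1 := ht.sent_le_climb _ _ _ _ hτ hvw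
    have h2 := hadm.2.2 _ _ _ _ hτ
    rw [HST.weight_of_isChild hvw] at h2
    rw [hvw.height_eq, HST.climb_succ]
    linarith

variable [Fintype V]

/-- A message becomes late in a subtree only by entering it. -/
theorem Timed.of_late_hop (ht : Timed s) (hs : Wired s) (h : Hop s s' r v w z) {c : V} {r' : R}
    (hl : Late s' c r') : Late s c r' ∨ (r' = r ∧ w = c ∧ I.T.IsChild c v ∧ OnEdge s r c v) := by
  obtain ⟨a, b, τ, hτ, hba, hca, hlt⟩ := hl
  rcases h.of_transit hτ with ⟨-, h1⟩ | ⟨rfl, hne, rfl, rfl, rfl⟩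
  · exact Or.inl ⟨a, b, τ, h1, hba, hca, hlt⟩
  by_cases hwv : I.T.IsChild a v
  · rcases h.source with ⟨-, rfl, -⟩ | ⟨τ, hτ', -, -, hadm, -⟩
    · exact absurd rfl hwv.ne
    have h2 := hadm.2.2 _ _ _ _ hτ'
    rw [HST.weight_comm, HST.weight_of_isChild hwv] at h2
    by_cases hac : a = c
    · subst hac
      exact Or.inr ⟨rfl, rfl, hwv, (onEdge_of_transit hτ').symm⟩
    · refine Or.inl ⟨v, a, τ, hτ', hwv, hca.of_isChild hwv hac, ?_⟩
      rw [hwv.height_eq, HST.climb_succ]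
      linarith
  · have h2 := ht.now_le_climb hs h hwv
    have h3 : I.T.climb (I.T.height a) ≤ I.T.climb (I.T.height c) := HST.climb_mono hca.le
    linarith

theorem Timed.hop (ht : Timed s) (hs : Wired s) (h : Hop s s' r v w z) : Timed s' := by
  have hmono := h.now_le
  refine ⟨ht.now_nonneg.trans hmono, ?_, ?_, ?_, ?_, ?_, ?_⟩
  · intro r' hr'
    have hne : r' ≠ r := by rintro rfl; exact h.status_ne_waiting hr'
    rw [h.status_of_ne hne] at hr'
    rw [h.now_eq_of_waiting hr']
    exact ht.now_eq_zero r' hr'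
  · intro r' x y τ hτ
    rcases h.of_transit hτ with ⟨-, h1⟩ | ⟨-, -, -, -, rfl⟩
    · exact (ht.sent_le _ _ _ _ h1).trans hmono
    · exact le_rfl
  · intro r' x y τ hτ
    rcases h.of_transit hτ with ⟨-, h1⟩ | ⟨-, -, -, -, rfl⟩
    · rcases h.source with ⟨hr, -⟩ | ⟨-, -, -, -, hadm, -⟩
      · rw [h.now_eq_of_waiting hr]; exact ht.now_le _ _ _ _ h1
      · exact hadm.2.2 _ _ _ _ h1
    · exact le_add_of_nonneg_right (HST.weight_pos _ _).le
  · intro r' x y τ hτ hxy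
    rcases h.of_transit hτ with ⟨-, h1⟩ | ⟨-, -, rfl, rfl, rfl⟩
    · exact ht.sent_le_climb _ _ _ _ h1 hxy
    · exact ht.now_le_climb hs h fun hv => hs.not_up_of_down h hv hxy
  · intro c r' hl
    rcases ht.of_late_hop hs h hl with h1 | ⟨-, rfl, hcv, -⟩
    · obtain ⟨p, hp, hcp⟩ := ht.late_link c r' h1
      refine ⟨p, ?_, hcp⟩
      rw [h.mem_links]
      split_ifs with hcw
      · subst hcw
        refine Or.inr ⟨hp, ?_⟩
        rintro rfl
        have h2 := ht.now_le_climb hs h fun hv => hs.not_up_of_down h hv hcp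
        have h3 := ht.climb_lt_of_late h1
        linarith
      · exact hp
    · exact ⟨v, by rw [h.mem_links, if_pos rfl]; exact Or.inl rfl, hcv⟩
  · have key : ∀ c r', Late s c r' → ¬ (I.T.IsChild c v ∧ OnEdge s r c v) := by
      rintro c r' hl ⟨hcv, he⟩
      obtain ⟨p, hp, hcp⟩ := ht.late_link c r' hl
      rw [hcp.unique hcv] at hp
      exact hs.not_mem_links _ _ _ he hp
    intro c r1 r2 hl1 hl2
    rcases ht.of_late_hop hs h hl1 with h1 | ⟨e1, -, h1⟩ <;>
      rcases ht.of_late_hop hs h hl2 with h2 | ⟨e2, -, h2⟩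
    · exact ht.late_unique c r1 r2 h1 h2
    · exact absurd h2 (key c r1 h1)
    · exact absurd h1 (key c r2 h2)
    · rw [e1, e2]

/-! ### Subtrees without servers and requests -/

/-- There is a server in the subtree of `c`. -/
def HasServer (I : DSMS V R) (c : V) : Prop := ∃ z, I.T.InSubtree c (I.server z)

/-- There is a request in the subtree of `c`. -/
def HasRequest (I : DSMS V R) (c : V) : Prop := ∃ r, I.T.InSubtree c (I.node r)

/-- Subtrees without servers and requests stay untouched. -/
theorem untouched (hs : Relation.ReflTransGen I.Step I.init s) {c : V} (hc : ¬ I.HasServer c)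
    (hc' : ¬ I.HasRequest c) : (∃ p ∈ s.links c, I.T.IsChild c p) ∧
      ∀ r u x, OnEdge s r u x → I.T.InSubtree c u → ¬ I.T.InSubtree c x := by
  refine (Wired.induction (P := fun s : I.State => (∃ p ∈ s.links c, I.T.IsChild c p) ∧
      ∀ r u x, OnEdge s r u x → I.T.InSubtree c u → ¬ I.T.InSubtree c x) ?_ ?_ hs).2
  · refine ⟨⟨I.T.parent c, Or.inr (Or.inr ⟨rfl, hc⟩), HST.isChild_parent ?_⟩, ?_⟩
    · rintro rfl
      exact hc ⟨⟨0, I.one_le_k⟩, I.T.inSubtree_root _⟩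
    · rintro r u x ⟨τ, h | h⟩ <;> cases h
  · rintro s s' r v w z hs ⟨⟨p, hp, hcp⟩, hmsg⟩ h
    -- The hop cannot involve the subtree of `c`: a message from above would come in over the link.
    have hw : ¬ I.T.InSubtree c w := by
      intro hw
      rcases h.source_cases with ⟨-, -, rfl⟩ | he
      · exact hc' ⟨r, hw⟩
      · by_cases hv : I.T.InSubtree c v
        · exact hmsg _ _ _ he hv hw
        · rcases hs.adj _ _ _ he with h1 | h1
          · exact hv (hw.trans h1.inSubtree)
          · by_cases hwc : w = c
            · subst hwc
              rw [hcp.unique h1] at hp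
              exact hs.not_mem_links _ _ _ he.symm hp
            · exact hv (hw.of_isChild h1 hwc)
    refine ⟨⟨p, ?_, hcp⟩, ?_⟩
    · rw [h.links_of_ne]
      · exact hp
      · rintro rfl; exact hw (HST.InSubtree.refl _)
    · intro r' u x he hu hx
      rcases h.of_onEdge he with ⟨-, h1⟩ | ⟨-, -, ⟨rfl, -⟩ | ⟨-, rfl⟩⟩
      · exact hmsg _ _ _ h1 hu hx
      · exact hw hu
      · exact hw hx

end

end DSMS

/-! ### Counting the messages in transit -/

namespace DSMS

variable {V R : Type*} {I : DSMS V R}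

/-- The message of `r` is in transit over an edge both of whose ends have height at least `i`. -/
def High (s : I.State) (i : ℕ) (r : R) : Prop :=
  ∃ u x τ, s.status r = Status.transit u x τ ∧ i ≤ I.T.height u ∧ i ≤ I.T.height x

/-- The vertex `c` has height `i` and points to its parent. -/
def Up (s : I.State) (i : ℕ) (c : V) : Prop :=
  I.T.height c = i ∧ ∃ p ∈ s.links c, I.T.IsChild c p

/-- The message of `r` is in transit. -/
def InTransit (s : I.State) (r : R) : Prop := ∃ u x τ, s.status r = Status.transit u x τ

theorem sum_add_sum_le_of_eq_off {ι κ : Type*} [Fintype ι] [Fintype κ] {f f' : ι → ℕ}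
    {g g' : κ → ℕ} (i : ι) (j : κ) (hf : ∀ x, x ≠ i → f' x = f x) (hg : ∀ y, y ≠ j → g' y = g y)
    (h : f' i + g' j ≤ f i + g j) : ∑ x, f' x + ∑ y, g' y ≤ ∑ x, f x + ∑ y, g y := by
  classical
  rw [← Finset.add_sum_erase _ f (Finset.mem_univ i),
    ← Finset.add_sum_erase _ f' (Finset.mem_univ i),
    ← Finset.add_sum_erase _ g (Finset.mem_univ j),
    ← Finset.add_sum_erase _ g' (Finset.mem_univ j),
    Finset.sum_congr rfl fun x hx => hf x (Finset.ne_of_mem_erase hx),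
    Finset.sum_congr rfl fun y hy => hg y (Finset.ne_of_mem_erase hy)]
  linarith

section

variable {s s' : I.State}

open Classical in
/-- A hop moves a message from the edge that it frees to a link that it takes: messages above the
height `i` are paid for by links that point from height `i` to height `i + 1`. -/
theorem Wired.indicator_le [DecidableEq V] [DecidableEq R] {r : R} {v w z : V} (hs : Wired s)
    (h : Hop s s' r v w z) (i : ℕ) :
    (if High s' i r then 1 else 0) + (if Up s' i w then 1 else 0) ≤
      (if High s i r then 1 else 0) + (if Up s i w then 1 else 0) := by
  have hhigh : High s' i r → z ≠ w ∧ i ≤ I.T.height w ∧ i ≤ I.T.height z := by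
    rintro ⟨u, x, τ, hτ, hu, hx⟩
    rcases h.of_transit hτ with ⟨h1, -⟩ | ⟨-, h1, rfl, rfl, -⟩
    · exact absurd rfl h1
    · exact ⟨h1, hu, hx⟩
  have hup : Up s' i w → I.T.height w = i ∧ (I.T.IsChild w v ∨
      ∃ p ∈ s.links w, p ≠ z ∧ I.T.IsChild w p) := by
    rintro ⟨h1, p, hp, hwp⟩
    rw [h.mem_links, if_pos rfl] at hp
    refine ⟨h1, ?_⟩
    rcases hp with rfl | hp
    · exact Or.inl hwp
    · exact Or.inr ⟨p, hp.1, hp.2, hwp⟩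
  have hsrc : ∀ j, j ≤ I.T.height w → j ≤ I.T.height v → v ≠ w → High s j r := by
    intro j h1 h2 h3
    rcases h.source with ⟨-, h4, -⟩ | ⟨τ, hτ, -⟩
    · exact absurd h4 h3
    · exact ⟨v, w, τ, hτ, h2, h1⟩
  by_cases hwz : I.T.IsChild w z ∧ I.T.height w = i
  · -- The message leaves height `i` upwards, and `w` gives up its only link to its parent.
    have h1 : Up s i w := ⟨hwz.2, z, h.choice.1, hwz.1⟩
    have h2 : ¬ Up s' i w := by
      intro h2
      rcases (hup h2).2 with h3 | ⟨p, -, h3, h4⟩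
      · exact hs.not_up_of_down h h3 hwz.1
      · exact h3 (h4.unique hwz.1)
    rw [if_pos h1, if_neg h2]
    split_ifs <;> omega
  · have h1 : High s' i r → High s i r ∧ ¬ Up s' i w := by
      intro h1
      obtain ⟨h2, h3, h4⟩ := hhigh h1
      have hlt : i < I.T.height w := by
        rcases (hs.target_adj h).resolve_left fun e => h2 e.1 with h5 | h5
        · have := h5.height_eq; omega
        · exact lt_of_le_of_ne h3 fun e => hwz ⟨h5, e.symm⟩
      refine ⟨?_, fun h5 => by have := (hup h5).1; omega⟩
      rcases hs.source_adj h with ⟨-, h5⟩ | h5 | h5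
      · rw [h5, (I.node_leaf r).height_eq] at hlt; omega
      · exact hsrc i h3 (by have := h5.height_eq; omega) h5.ne
      · exact hsrc i h3 (by have := h5.height_eq; omega) h5.ne.symm
    have h2 : Up s' i w → High s i r ∨ Up s i w := by
      intro h2
      obtain ⟨h3, h4 | ⟨p, hp, -, hwp⟩⟩ := hup h2
      · exact Or.inl (hsrc i h3.ge (by have := h4.height_eq; omega) h4.ne.symm)
      · exact Or.inr ⟨h3, p, hp, hwp⟩
    by_cases h3 : High s' i r
    · rw [if_pos h3, if_pos (h1 h3).1, if_neg (h1 h3).2]; omega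
    · by_cases h4 : Up s' i w
      · rw [if_neg h3, if_pos h4]
        rcases h2 h4 with h5 | h5 <;> rw [if_pos h5] <;> omega
      · rw [if_neg h3, if_neg h4]; omega

variable [Fintype V]

open Classical in
theorem card_high_add_card_up_le [DecidableEq V] [Fintype R] [DecidableEq R]
    (hs : Relation.ReflTransGen I.Step I.init s) (i : ℕ) :
    (Finset.univ.filter (High s i)).card + (Finset.univ.filter (Up s i)).card ≤
      (Finset.univ.filter fun c => I.T.height c = i ∧ ¬ I.HasServer c).card := by
  refine (Wired.induction (P := fun s : I.State => (Finset.univ.filter (High s i)).card +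
    (Finset.univ.filter (Up s i)).card ≤
      (Finset.univ.filter fun c => I.T.height c = i ∧ ¬ I.HasServer c).card) ?_ ?_ hs).2
  · have h1 : Finset.univ.filter (High I.init i) = ∅ := by
      refine Finset.filter_eq_empty_iff.2 ?_
      rintro r - ⟨u, x, τ, h, -⟩
      cases h
    rw [h1, Finset.card_empty, zero_add]
    refine Finset.card_le_card (Finset.monotone_filter_right _ ?_)
    rintro c - ⟨h2, p, hp, hcp⟩
    refine ⟨h2, ?_⟩
    rcases hp with h3 | h3 | h3
    · exact absurd hcp h3.1.asymm
    · exact absurd h3.1.symm hcp.ne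
    · exact h3.2
  · intro s s' r v w z hs hP h
    refine le_trans ?_ hP
    simp only [Finset.card_filter]
    refine sum_add_sum_le_of_eq_off r w ?_ ?_ (hs.indicator_le h i)
    · intro r' hr'
      have : High s' i r' ↔ High s i r' := by simp only [High, h.status_of_ne hr']
      simp only [this]
    · intro c hc
      have : Up s' i c ↔ Up s i c := by simp only [Up, h.links_of_ne hc]
      simp only [this]

variable (I) in
open Classical in
/-- The vertices whose subtree contains requests, but no server.  Some message has to leave such a
subtree. -/
noncomputable def needy : Finset V := Finset.univ.filter fun c => ¬ I.HasServer c ∧ I.HasRequest c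

theorem mem_needy {c : V} : c ∈ I.needy ↔ ¬ I.HasServer c ∧ I.HasRequest c := by
  classical
  simp [needy]

theorem height_lt_of_mem_needy {c : V} (hc : c ∈ I.needy) : I.T.height c < I.T.depth := by
  refine lt_of_le_of_ne (I.T.height_le_depth c) fun e => ?_
  have := HST.eq_root_of_height_eq e
  subst this
  exact (mem_needy.1 hc).1 ⟨⟨0, I.one_le_k⟩, I.T.inSubtree_root _⟩

open Classical in
/-- After the time `2 * climb i`, at most as many messages are in transit as there are needy
vertices of height `i`: every message below height `i` is late in the subtree of a vertex that
points to its parent. -/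
theorem card_inTransit_le [DecidableEq V] [Fintype R] [DecidableEq R]
    (hs : Relation.ReflTransGen I.Step I.init s) (hw : Wired s) (ht : Timed s) {t : ℝ}
    (hadm : I.Admissible s t) {i : ℕ} (hi : i ≤ I.T.depth) (hlt : 2 * I.T.climb i < t) : (Finset.univ.filter (InTransit s)).card ≤
      (I.needy.filter fun c => I.T.height c = i).card := by
  have hlow : ∀ r, InTransit s r → ¬ High s i r → ∃ c u x τ, s.status r = Status.transit u x τ ∧
      I.T.height c = i ∧ I.T.InSubtree c u ∧ I.T.InSubtree c x := by
    rintro r ⟨u, x, τ, hτ⟩ hr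
    have key : ∀ a b, I.T.IsChild a b → I.T.height a < i →
        ∃ c, I.T.height c = i ∧ I.T.InSubtree c b ∧ I.T.InSubtree c a := by
      intro a b hab ha
      obtain ⟨c, hc, hci⟩ := I.T.exists_ancestor b (by rw [hab.height_eq]; exact ha) hi
      exact ⟨c, hci, hc, hc.trans hab.inSubtree⟩
    have hmin : I.T.height u < i ∨ I.T.height x < i := by
      by_contra hcon
      push Not at hcon
      exact hr ⟨u, x, τ, hτ, hcon⟩
    rcases hw.adj _ _ _ (onEdge_of_transit hτ) with h1 | h1
    · obtain ⟨c, h2, h3, h4⟩ := key u x h1 (by have := h1.height_eq; omega)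
      exact ⟨c, u, x, τ, hτ, h2, h4, h3⟩
    · obtain ⟨c, h2, h3, h4⟩ := key x u h1 (by have := h1.height_eq; omega)
      exact ⟨c, u, x, τ, hτ, h2, h3, h4⟩
  have hlate : ∀ c r u x τ, s.status r = Status.transit u x τ → I.T.height c = i →
      I.T.InSubtree c u → I.T.InSubtree c x → Late s c r := fun c r u x τ hτ hc hu hx =>
    ht.late_of_admissible hw hadm (hc ▸ hlt) hτ hu hx
  have : Nonempty V := ⟨I.T.root⟩
  choose! f hf using hlow
  set U := Finset.univ.filter (Up s i)
  set E := Finset.univ.filter fun c => I.T.height c = i ∧ ¬ I.HasServer c ∧ ¬ I.HasRequest c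
  have hEU : E ⊆ U := by
    intro c hc
    obtain ⟨h1, h2, h3⟩ := (Finset.mem_filter.1 hc).2
    exact Finset.mem_filter.2 ⟨Finset.mem_univ _, h1, (untouched hs h2 h3).1⟩
  have h1 : (Finset.univ.filter fun r => InTransit s r ∧ ¬ High s i r).card ≤ (U \ E).card := by
    refine Finset.card_le_card_of_injOn f ?_ ?_
    · intro r hr
      obtain ⟨hr1, hr2⟩ := (Finset.mem_filter.1 hr).2
      obtain ⟨u, x, τ, hτ, hc, hu, hx⟩ := hf r hr1 hr2
      simp only [Finset.coe_sdiff, Set.mem_sdiff, Finset.mem_coe]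
      refine ⟨Finset.mem_filter.2 ⟨Finset.mem_univ _, hc,
        ht.late_link _ _ (hlate _ _ _ _ _ hτ hc hu hx)⟩, fun hE => ?_⟩
      obtain ⟨-, h2, h3⟩ := (Finset.mem_filter.1 hE).2
      exact (untouched hs h2 h3).2 _ _ _ (onEdge_of_transit hτ) hu hx
    · intro r hr r' hr' he
      obtain ⟨hr1, hr2⟩ := (Finset.mem_filter.1 hr).2
      obtain ⟨hr1', hr2'⟩ := (Finset.mem_filter.1 hr').2
      obtain ⟨u, x, τ, hτ, hc, hu, hx⟩ := hf r hr1 hr2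
      obtain ⟨u', x', τ', hτ', hc', hu', hx'⟩ := hf r' hr1' hr2'
      have h3 := hlate _ _ _ _ _ hτ' hc' hu' hx'
      rw [← he] at h3
      exact ht.late_unique _ _ _ (hlate _ _ _ _ _ hτ hc hu hx) h3
  rw [Finset.card_sdiff_of_subset hEU] at h1
  have h2 : _ + U.card ≤ _ := card_high_add_card_up_le hs i
  have h3 : (Finset.univ.filter fun c => I.T.height c = i ∧ ¬ I.HasServer c).card =
      (I.needy.filter fun c => I.T.height c = i).card + E.card := by
    rw [← Finset.card_union_of_disjoint]
    · congr 1
      ext c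
      simp only [Finset.mem_filter, Finset.mem_union, mem_needy, Finset.mem_univ, true_and, E]
      tauto
    · rw [Finset.disjoint_left]
      intro c hc hc'
      exact (Finset.mem_filter.1 hc').2.2.2 (mem_needy.1 (Finset.mem_filter.1 hc).1).2
  have h4 : (Finset.univ.filter (InTransit s)).card ≤ (Finset.univ.filter (High s i)).card +
      (Finset.univ.filter fun r => InTransit s r ∧ ¬ High s i r).card := by
    refine le_trans (Finset.card_le_card ?_) (Finset.card_union_le _ _)
    intro r hr
    have hr := (Finset.mem_filter.1 hr).2
    by_cases hh : High s i r <;> simp [hh, hr]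
  have h5 := Finset.card_le_card hEU
  omega

end

/-! ### The cost of an execution -/

/-- The time that the message of `r` has spent so far on the edge over which it is in transit. -/
noncomputable def pending (s : I.State) (r : R) : ℝ :=
  match s.status r with
  | Status.transit _ _ τ => s.now - τ
  | _ => 0

theorem pending_eq_zero {s : I.State} {r : R} (h : ¬ InTransit s r) : pending s r = 0 := by
  rw [pending]
  split
  · rename_i hq
    exact absurd ⟨_, _, _, hq⟩ h
  · rfl

/-- The part of the time interval `[0, x]` that lies between `2 * climb i` and
`2 * climb (i + 1)`. -/
noncomputable def phase (I : DSMS V R) (i : ℕ) (x : ℝ) : ℝ :=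
  min x (2 * I.T.climb (i + 1)) - min x (2 * I.T.climb i)

theorem phase_le (i : ℕ) (x : ℝ) : I.phase i x ≤ 2 * I.T.α ^ i := by
  have h1 : (0 : ℝ) < I.T.α ^ i := pow_pos HST.alpha_pos i
  rw [phase, HST.climb_succ]
  rcases min_cases x (2 * I.T.climb i) with h | h <;>
    rcases min_cases x (2 * (I.T.climb i + I.T.α ^ i)) with h' | h' <;> linarith

theorem phase_mono (i : ℕ) : Monotone (I.phase i) := by
  intro x y hxy
  have h1 : (0 : ℝ) < I.T.α ^ i := pow_pos HST.alpha_pos i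
  simp only [phase, HST.climb_succ]
  rcases min_cases x (2 * I.T.climb i) with h | h <;>
    rcases min_cases x (2 * (I.T.climb i + I.T.α ^ i)) with h' | h' <;>
    rcases min_cases y (2 * I.T.climb i) with h2 | h2 <;>
    rcases min_cases y (2 * (I.T.climb i + I.T.α ^ i)) with h2' | h2' <;> linarith

theorem phase_eq_zero {i : ℕ} {x : ℝ} (h : x ≤ 2 * I.T.climb i) : I.phase i x = 0 := by
  have h1 : (0 : ℝ) < I.T.α ^ i := pow_pos HST.alpha_pos i
  rw [phase, HST.climb_succ, min_eq_left h, min_eq_left (by linarith), sub_self]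

theorem sum_phase {x : ℝ} (h0 : 0 ≤ x) (n : ℕ) (h : x ≤ 2 * I.T.climb n) :
    ∑ i ∈ Finset.range n, I.phase i x = x := by
  simp only [phase]
  rw [Finset.sum_range_sub fun i => min x (2 * I.T.climb i), HST.climb_zero, mul_zero,
    min_eq_left h, min_eq_right h0, sub_zero]

open Classical in
theorem Hop.pending_add [DecidableEq V] [DecidableEq R] {s s' : I.State} {r : R} {v w z : V}
    (h : Hop s s' r v w z) (r' : R) :
    pending s' r' + (if r' = r then s'.cost - s.cost else 0) =
      pending s r' + (if InTransit s r' then s'.now - s.now else 0) := by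
  by_cases hr : r' = r
  · subst hr
    have h1 : pending s' r' = 0 := by
      by_cases hz : z = w
      · obtain ⟨q, -, hq⟩ := h.status_self_of_eq hz
        simp only [pending, hq]
      · simp only [pending, h.status_self_of_ne hz, sub_self]
    rw [if_pos rfl, h1]
    rcases h.source with ⟨hq, -, -, -, -, hc⟩ | ⟨τ, hq, -, -, -, hc⟩
    · have h2 : ¬ InTransit s r' := by rintro ⟨u, x, τ, hτ⟩; rw [hq] at hτ; cases hτ
      rw [if_neg h2, hc]
      simp only [pending, hq]
      ring
    · rw [if_pos ⟨_, _, _, hq⟩, hc]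
      simp only [pending, hq]
      ring
  · rw [if_neg hr, add_zero]
    by_cases ht : InTransit s r'
    · obtain ⟨u, x, τ, hτ⟩ := id ht
      rw [if_pos ht]
      simp only [pending, h.status_of_ne hr, hτ]
      ring
    · have ht' : ¬ InTransit s' r' := by rwa [InTransit, h.status_of_ne hr]
      rw [if_neg ht, pending_eq_zero ht, pending_eq_zero ht', add_zero]

section

variable [Fintype V] [DecidableEq V] [DecidableEq R] {s s' : I.State} {r : R} {v w z : V}

theorem Timed.of_reachable (hs : Relation.ReflTransGen I.Step I.init s) : Timed s :=
  (Wired.induction (P := Timed) (Timed.init I)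
    (fun _ _ _ _ _ _ hs ht h => ht.hop hs h) hs).2

theorem Wired.of_reachable (hs : Relation.ReflTransGen I.Step I.init s) : Wired s :=
  (Wired.induction (P := fun _ => True) trivial (fun _ _ _ _ _ _ _ _ _ => trivial) hs).1

variable [Fintype R]

open Classical in
/-- While time passes from `s.now` to `t`, the messages in transit accumulate no more latency than
the needy vertices account for. -/
theorem card_mul_le_sum_phase (hs : Relation.ReflTransGen I.Step I.init s) {t : ℝ}
    (hadm : I.Admissible s t) (htd : t ≤ 2 * I.T.climb I.T.depth) :
    (Finset.univ.filter (InTransit s)).card * (t - s.now) ≤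
      ∑ c ∈ I.needy, (I.phase (I.T.height c) t - I.phase (I.T.height c) s.now) := by
  have hw := Wired.of_reachable hs
  have ht := Timed.of_reachable hs
  have h0 := ht.now_nonneg
  have hle := hadm.1
  rw [← Finset.sum_fiberwise_of_maps_to (t := Finset.range I.T.depth)
    (g := fun c => I.T.height c) fun c hc => Finset.mem_range.2 (height_lt_of_mem_needy hc)]
  conv_lhs => rw [← sum_phase (I := I) (h0.trans hle) I.T.depth htd,
    ← sum_phase (I := I) h0 I.T.depth (hle.trans htd), ← Finset.sum_sub_distrib, Finset.mul_sum]
  refine Finset.sum_le_sum fun i hi => ?_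
  have h1 : ∑ c ∈ I.needy with I.T.height c = i,
      (I.phase (I.T.height c) t - I.phase (I.T.height c) s.now) =
      (I.needy.filter fun c => I.T.height c = i).card * (I.phase i t - I.phase i s.now) := by
    rw [← nsmul_eq_mul]
    refine Finset.sum_eq_card_nsmul fun c hc => ?_
    rw [(Finset.mem_filter.1 hc).2]
  rw [h1]
  by_cases hlt : 2 * I.T.climb i < t
  · refine mul_le_mul_of_nonneg_right ?_ (sub_nonneg.2 (phase_mono i hle))
    exact_mod_cast card_inTransit_le hs hw ht hadm (Finset.mem_range.1 hi).le hlt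
  · rw [not_lt] at hlt
    rw [phase_eq_zero hlt, phase_eq_zero (hle.trans hlt)]
    simp

open Classical in
/-- Along an execution, the latencies so far are covered by the needy vertices. -/
theorem cost_add_pending_le (hs : Relation.ReflTransGen I.Step I.init s) :
    s.cost + ∑ r, pending s r ≤ ∑ c ∈ I.needy, I.phase (I.T.height c) s.now := by
  induction hs with
  | refl =>
    have h1 : ∀ i, I.phase i 0 = 0 := fun i =>
      phase_eq_zero (mul_nonneg zero_le_two (HST.climb_nonneg i))
    simp [DSMS.init, pending, h1]
  | tail hs hstep ih =>
    rename_i s1 s2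
    obtain ⟨r, v, w, z, h⟩ := hstep.exists_hop
    have h1 := Finset.sum_congr rfl fun r' (_ : r' ∈ (Finset.univ : Finset R)) => h.pending_add r'
    rw [Finset.sum_add_distrib, Finset.sum_add_distrib, Finset.sum_ite_eq' Finset.univ r,
      if_pos (Finset.mem_univ r), ← Finset.sum_filter, Finset.sum_const, nsmul_eq_mul] at h1
    have h2 : (Finset.univ.filter (InTransit s1)).card * (s2.now - s1.now) ≤
        ∑ c ∈ I.needy, (I.phase (I.T.height c) s2.now - I.phase (I.T.height c) s1.now) := by
      rcases h.source with ⟨-, -, -, -, h2, -⟩ | ⟨τ, h2, -, -, hadm, -⟩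
      · simp [h2]
      · exact card_mul_le_sum_phase hs hadm
          ((Timed.of_reachable hs).le_of_admissible (Wired.of_reachable hs) hadm h2)
    rw [Finset.sum_sub_distrib] at h2
    linarith

theorem cost_le (hs : Relation.ReflTransGen I.Step I.init s)
    (hfin : ∀ r, ∃ q, s.status r = Status.scheduled q) :
    s.cost ≤ ∑ c ∈ I.needy, 2 * I.T.α ^ I.T.height c := by
  have h1 := cost_add_pending_le hs
  have h2 : ∀ r, pending s r = 0 := fun r => by
    obtain ⟨q, hq⟩ := hfin r
    simp only [pending, hq]
  simp only [h2, Finset.sum_const_zero, add_zero] at h1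
  exact h1.trans (Finset.sum_le_sum fun c _ => phase_le _ _)

end

end DSMS

/-! ### The cost of offline protocols -/

namespace HST

variable {V : Type*} (T : HST V) [Fintype V]

open Classical in
/-- The length of the part of the path from `a` to `b` that ascends. -/
noncomputable def ascent (a b : V) : ℝ :=
  ∑ c, if T.InSubtree c a ∧ ¬ T.InSubtree c b then T.α ^ T.height c else 0

variable {T}

theorem ascent_self (a : V) : T.ascent a a = 0 :=
  Finset.sum_eq_zero fun _ _ => if_neg fun h => h.2 h.1

theorem ascent_triangle (a b c : V) : T.ascent a c ≤ T.ascent a b + T.ascent b c := by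
  rw [ascent, ascent, ascent, ← Finset.sum_add_distrib]
  refine Finset.sum_le_sum fun x _ => ?_
  have h : 0 < T.α ^ T.height x := pow_pos alpha_pos _
  by_cases h1 : T.InSubtree x a <;> by_cases h2 : T.InSubtree x b <;>
    by_cases h3 : T.InSubtree x c <;> simp [h1, h2, h3, h.le]

theorem ascent_add_ascent_of_isChild {c v : V} (h : T.IsChild c v) :
    T.ascent c v + T.ascent v c ≤ T.α ^ T.height c := by
  have h1 : T.ascent v c = 0 :=
    Finset.sum_eq_zero fun x _ => if_neg fun hx => hx.2 (hx.1.trans h.inSubtree)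
  rw [h1, add_zero, ascent]
  rw [Finset.sum_eq_single c]
  · split_ifs
    · exact le_rfl
    · exact (pow_pos alpha_pos _).le
  · intro x _ hx
    exact if_neg fun hx' => hx'.2 (hx'.1.of_isChild h hx.symm)
  · exact fun hc => absurd (Finset.mem_univ c) hc

theorem ascent_add_ascent_le_of_adj {u v : V} (h : T.graph.Adj u v) :
    T.ascent u v + T.ascent v u ≤ T.weight u v := by
  rcases adj_iff.1 h with h | h
  · rw [weight_of_isChild h]; exact ascent_add_ascent_of_isChild h
  · rw [weight_comm, weight_of_isChild h, add_comm]; exact ascent_add_ascent_of_isChild h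

/-- Every walk is at least as long as the path between its ends. -/
theorem ascent_add_ascent_le {u v : V} (p : T.graph.Walk u v) :
    T.ascent u v + T.ascent v u ≤ (p.darts.map fun d => T.weight d.fst d.snd).sum := by
  induction p with
  | nil => simp [ascent_self]
  | @cons u v w h p ih =>
    rw [SimpleGraph.Walk.darts_cons, List.map_cons, List.sum_cons]
    have h1 := T.ascent_add_ascent_le_of_adj h
    have h2 := T.ascent_triangle u v w
    have h3 := T.ascent_triangle w v u
    linarith

open Classical in
theorem sum_ancestors (a : V) (ha : T.IsLeaf a) :
    (∑ c, if T.InSubtree c a then T.α ^ T.height c else 0) = T.climb (T.depth + 1) := by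
  rw [← Finset.sum_filter, climb]
  refine Finset.sum_bij (fun c _ => T.height c) ?_ ?_ ?_ ?_
  · intro c _
    exact Finset.mem_range.2 (Nat.lt_succ_of_le (T.height_le_depth c))
  · intro c hc d hd h
    exact (Finset.mem_filter.1 hc).2.eq_of_height_eq (Finset.mem_filter.1 hd).2 h
  · intro i hi
    obtain ⟨c, hc, hci⟩ := T.exists_ancestor a (i := i) (by rw [ha.height_eq]; exact Nat.zero_le i)
      (Nat.lt_succ_iff.1 (Finset.mem_range.1 hi))
    exact ⟨c, Finset.mem_filter.2 ⟨Finset.mem_univ _, hc⟩, hci⟩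
  · exact fun _ _ => rfl

/-- A path between leaves ascends as much as it descends. -/
theorem ascent_comm {a b : V} (ha : T.IsLeaf a) (hb : T.IsLeaf b) :
    T.ascent a b = T.ascent b a := by
  classical
  have h := (sum_ancestors a ha).trans (sum_ancestors b hb).symm
  have key : ∀ a b : V, T.ascent a b = (∑ c, if T.InSubtree c a then T.α ^ T.height c else 0) -
      ∑ c, if T.InSubtree c a ∧ T.InSubtree c b then T.α ^ T.height c else 0 := by
    intro a b
    rw [ascent, ← Finset.sum_sub_distrib]
    refine Finset.sum_congr rfl fun c _ => ?_
    by_cases h1 : T.InSubtree c a <;> by_cases h2 : T.InSubtree c b <;> simp [h1, h2]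
  rw [key a b, key b a, h]
  simp only [and_comm]

end HST

namespace DSMS

variable {V R : Type*} {I : DSMS V R}

theorem loc_leaf (q : I.Req) : I.T.IsLeaf (I.loc q) := by
  rcases q with z | r
  · exact I.server_leaf z
  · exact I.node_leaf r

/-- In a solution, some request in a subtree with requests, but no server, has its predecessor
outside the subtree: the first such request of any schedule. -/
theorem IsSolution.exists_crossing {pred : R → I.Req} (h : I.IsSolution pred) {c : V}
    (hs : ¬ I.HasServer c) (hr : I.HasRequest c) :
    ∃ r, I.T.InSubtree c (I.node r) ∧ ¬ I.T.InSubtree c (I.loc (pred r)) := by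
  obtain ⟨queue, hnodup, huniq, hpred⟩ := h
  by_contra hcon
  push Not at hcon
  have key : ∀ (n : ℕ) z r, r ∈ queue z → I.T.InSubtree c (I.node r) →
      ((Sum.inl z : I.Req) :: (queue z).map Sum.inr)[n]? = some (Sum.inr r) → False := by
    intro n
    induction n using Nat.strong_induction_on with
    | _ n ih =>
      intro z r hrz hrc hn
      obtain ⟨z', s, t, hst⟩ := hpred r
      have hmem : ∀ q ∈ s ++ [pred r, Sum.inr r] ++ t, q = Sum.inl z' ∨ ∃ r' ∈ queue z',
          Sum.inr r' = q := by
        intro q hq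
        rw [hst] at hq
        simpa using hq
      have hz : z' = z := by
        rcases hmem (Sum.inr r) (by simp) with h1 | ⟨r', h1, h2⟩
        · cases h1
        · cases h2
          exact (huniq r).unique h1 hrz
      subst hz
      have hnd : (s ++ [pred r, Sum.inr r] ++ t).Nodup := by
        rw [hst, List.nodup_cons]
        exact ⟨by simp, (hnodup z').map Sum.inr_injective⟩
      have h1 : (s ++ [pred r, Sum.inr r] ++ t)[s.length]? = some (pred r) := by simp
      have h2 : (s ++ [pred r, Sum.inr r] ++ t)[s.length + 1]? = some (Sum.inr r) := by simp
      have hlt : s.length < n := by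
        rw [← hst] at hn
        have := (List.getElem?_inj (i := s.length + 1) (j := n) (by simp) hnd).1
          (h2.trans hn.symm)
        omega
      rw [hst] at h1
      have hpc := hcon r hrc
      rcases hmem (pred r) (by simp) with h3 | ⟨r', h3, h4⟩
      · rw [h3] at hpc
        exact hs ⟨z', hpc⟩
      · rw [← h4] at hpc h1
        exact ih _ hlt z' r' h3 hpc h1
  obtain ⟨r, hr⟩ := hr
  obtain ⟨z, hz, -⟩ := huniq r
  obtain ⟨n, hn⟩ := List.getElem?_of_mem
    (List.mem_cons_of_mem (Sum.inl z : I.Req) (List.mem_map_of_mem (f := Sum.inr) hz))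
  exact key n z r hz hr hn

/-- The latencies that are as large as possible. -/
noncomputable def Latencies.worst (I : DSMS V R) : I.Latencies where
  val _ _ u v := I.T.weight u v
  pos _ _ _ _ _ := HST.weight_pos _ _
  le_weight _ _ _ _ _ := le_rfl

variable [Fintype V] [Fintype R]

theorem sum_needy_le_cost (o : I.Outcome) :
    ∑ c ∈ I.needy, 2 * I.T.α ^ I.T.height c ≤ o.cost (Latencies.worst I) := by
  classical
  have h1 : ∀ r, 2 * I.T.ascent (I.node r) (I.loc (o.pred r)) ≤
      ∑ j : Fin (o.transmissions r).length, (Latencies.worst I).val r j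
        ((o.transmissions r).get j).fst ((o.transmissions r).get j).snd := by
    intro r
    have h2 := I.T.ascent_add_ascent_le (o.route r)
    rw [I.T.ascent_comm (I.loc_leaf _) (I.node_leaf r), ← two_mul] at h2
    refine h2.trans ?_
    have h3 := Fin.sum_univ_fun_getElem (o.transmissions r) fun d => I.T.weight d.fst d.snd
    refine le_trans ?_ h3.ge
    rw [Outcome.transmissions, List.map_append, List.sum_append]
    refine le_add_of_nonneg_right (List.sum_nonneg ?_)
    simp only [List.mem_map]
    rintro x ⟨d, -, rfl⟩
    exact (HST.weight_pos _ _).le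
  refine le_trans ?_ (Finset.sum_le_sum fun r _ => h1 r)
  simp only [← Finset.mul_sum, HST.ascent]
  rw [Finset.sum_comm]
  refine mul_le_mul_of_nonneg_left ?_ zero_le_two
  have hnn : ∀ c r, 0 ≤ if I.T.InSubtree c (I.node r) ∧ ¬ I.T.InSubtree c (I.loc (o.pred r)) then
      I.T.α ^ I.T.height c else 0 := by
    intro c r
    split_ifs
    · exact (pow_pos HST.alpha_pos _).le
    · exact le_rfl
  refine le_trans (Finset.sum_le_sum fun c hc => ?_)
    (Finset.sum_le_sum_of_subset_of_nonneg (Finset.subset_univ I.needy)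
      fun c _ _ => Finset.sum_nonneg fun r _ => hnn c r)
  obtain ⟨hc1, hc2⟩ := mem_needy.1 hc
  obtain ⟨r, hr⟩ := o.isSolution.exists_crossing hc1 hc2
  refine le_trans ?_ (Finset.single_le_sum (fun r _ => hnn c r) (Finset.mem_univ r))
  rw [if_pos hr]

theorem sum_needy_le_offlineOptimum :
    ((∑ c ∈ I.needy, 2 * I.T.α ^ I.T.height c : ℝ) : EReal) ≤ I.offlineOptimum :=
  le_iInf fun P => le_trans (EReal.coe_le_coe_iff.2 (sum_needy_le_cost (P (Latencies.worst I))))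
    (le_iSup (fun l => (((P l).cost l : ℝ) : EReal)) (Latencies.worst I))

end DSMS

/-! ### Every execution ends, with all requests scheduled -/

namespace DSMS

variable {V R : Type*} {I : DSMS V R}

open Classical in
/-- A bound on the number of steps that are still to be taken for a request. -/
noncomputable def stepsLeft (I : DSMS V R) : I.Status → ℕ
  | Status.waiting => 2 * I.T.depth + 2
  | Status.transit u v _ =>
    if I.T.IsChild u v then 2 * I.T.depth + 1 - I.T.height u else I.T.height v + 1
  | Status.scheduled _ => 0

section

variable [Fintype V] [DecidableEq V] [DecidableEq R] {s s' : I.State} {r : R} {v w z : V}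

theorem Wired.stepsLeft_lt (hs : Wired s) (h : Hop s s' r v w z) :
    I.stepsLeft (s'.status r) < I.stepsLeft (s.status r) := by
  by_cases hz : z = w
  · obtain ⟨q, -, hq⟩ := h.status_self_of_eq hz
    rw [hq]
    rcases h.source with ⟨h1, -⟩ | ⟨τ, h1, -⟩ <;> rw [h1] <;> simp only [stepsLeft]
    · omega
    · split_ifs with h2
      · have := h2.height_lt; omega
      · omega
  · rw [h.status_self_of_ne hz]
    have hz' := (hs.target_adj h).resolve_left fun h => hz h.1
    rcases h.source with ⟨h1, h2, h3, -⟩ | ⟨τ, h1, -⟩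
    · rw [h1]
      simp only [stepsLeft]
      have hl : I.T.IsLeaf w := h3 ▸ I.node_leaf r
      rw [if_pos (hz'.resolve_left (hl z))]
      omega
    · rw [h1]
      simp only [stepsLeft]
      rcases hs.adj _ _ _ (onEdge_of_transit h1) with h2 | h2
      · rw [if_pos h2]
        have h3 := h2.height_lt
        have h4 := h2.height_eq
        rcases hz' with h5 | h5
        · rw [if_neg h5.asymm]
          have := h5.height_eq
          omega
        · rw [if_pos h5]
          omega
      · rw [if_neg h2.asymm]
        have h5 := hz'.resolve_right (hs.not_up_of_down h h2)
        rw [if_neg h5.asymm]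
        have := h5.height_eq
        omega

theorem not_hasInfiniteExecution [Fintype R] (I : DSMS V R) : ¬ I.HasInfiniteExecution := by
  rintro ⟨run, h0, hstep⟩
  have hreach : ∀ n, Relation.ReflTransGen I.Step I.init (run n) := by
    intro n
    induction n with
    | zero => rw [h0]
    | succ n ih => exact ih.tail (hstep n)
  have hdec : ∀ n, ∑ r, I.stepsLeft ((run (n + 1)).status r) <
      ∑ r, I.stepsLeft ((run n).status r) := by
    intro n
    obtain ⟨r, v, w, z, h⟩ := (hstep n).exists_hop
    refine Finset.sum_lt_sum (fun r' _ => ?_)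
      ⟨r, Finset.mem_univ r, (Wired.of_reachable (hreach n)).stepsLeft_lt h⟩
    by_cases hr : r' = r
    · rw [hr]
      exact ((Wired.of_reachable (hreach n)).stepsLeft_lt h).le
    · rw [h.status_of_ne hr]
  have hsum : ∀ n, ∑ r, I.stepsLeft ((run n).status r) + n ≤
      ∑ r, I.stepsLeft ((run 0).status r) := by
    intro n
    induction n with
    | zero => exact le_rfl
    | succ n ih => have := hdec n; omega
  have := hsum (∑ r, I.stepsLeft ((run 0).status r) + 1)
  omega

theorem IsFinal.status_ne_waiting (hs : I.IsFinal s) (r : R) : s.status r ≠ Status.waiting := by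
  intro hr
  have hw := Wired.of_reachable hs.1
  obtain ⟨x, hx⟩ := hw.links_leaf _ (I.node_leaf r)
  by_cases hxr : x = I.node r
  · rw [hxr] at hx
    obtain ⟨q, hq⟩ := hw.last_isSome (I.node r) (hx ▸ rfl)
    exact hs.2 _ (Step.invokeLocal s r q hr hx hq)
  · exact hs.2 _ (Step.invokeSend s r x hr hx hxr)

theorem IsFinal.not_inTransit [Fintype R] (hs : I.IsFinal s) (r : R) : ¬ InTransit s r := by
  classical
  intro hr
  have hw := Wired.of_reachable hs.1
  have ht := Timed.of_reachable hs.1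
  -- The message with the earliest deadline can arrive at this deadline.
  let deadline : R → ℝ := fun r => match s.status r with
    | Status.transit u v τ => τ + I.T.weight u v
    | _ => 0
  have hd : ∀ r u v τ, s.status r = Status.transit u v τ → deadline r = τ + I.T.weight u v := by
    intro r u v τ h
    simp only [deadline, h]
  obtain ⟨r₀, hr₀, hmin⟩ := Finset.exists_min_image (Finset.univ.filter (InTransit s)) deadline
    ⟨r, Finset.mem_filter.2 ⟨Finset.mem_univ r, hr⟩⟩
  obtain ⟨v, w, τ, hτ⟩ := (Finset.mem_filter.1 hr₀).2
  have hadm : I.Admissible s (deadline r₀) := by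
    refine ⟨?_, hs.status_ne_waiting, fun r' u x τ' h' => ?_⟩
    · rw [hd _ _ _ _ hτ]; exact ht.now_le _ _ _ _ hτ
    · rw [← hd _ _ _ _ h']
      exact hmin r' (Finset.mem_filter.2 ⟨Finset.mem_univ _, _, _, _, h'⟩)
  have hlt : τ < deadline r₀ := by
    rw [hd _ _ _ _ hτ]; exact lt_add_of_pos_right _ (HST.weight_pos _ _)
  obtain ⟨z, hz⟩ : ∃ z, I.LegalChoice s w z := by
    by_cases h : ∃ c ∈ s.links w, I.T.IsChild c w
    · obtain ⟨c, hc, hcw⟩ := h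
      exact ⟨c, hc, fun _ => hcw⟩
    · obtain ⟨z, hz⟩ := hw.links_nonempty w
      exact ⟨z, hz, fun h' => absurd h' h⟩
  by_cases hzw : z = w
  · subst hzw
    obtain ⟨q, hq⟩ := hw.last_isSome z hz.1
    exact hs.2 _ (Step.arrive s r₀ v z τ _ q hτ hlt hadm hz hq)
  · exact hs.2 _ (Step.forward s r₀ v w z τ _ hτ hlt hadm hz hzw)

theorem IsFinal.exists_scheduled [Fintype R] (hs : I.IsFinal s) (r : R) :
    ∃ q, s.status r = Status.scheduled q := by
  have h1 := hs.status_ne_waiting r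
  have h2 := hs.not_inTransit r
  rcases hr : s.status r with _ | ⟨u, v, τ⟩ | q
  · exact absurd hr h1
  · exact absurd ⟨u, v, τ, hr⟩ h2
  · exact ⟨q, rfl⟩

end

/-! ### Solutions from predecessor assignments -/

/-- One step towards the head of a schedule; dummy requests are kept. -/
def back (pred : R → I.Req) : I.Req → I.Req := Sum.elim Sum.inl pred

theorem back_iterate_inl (pred : R → I.Req) (z : Fin I.k) (n : ℕ) :
    (back pred)^[n] (Sum.inl z) = Sum.inl z :=
  Function.iterate_fixed rfl n

theorem back_iterate_of_le {pred : R → I.Req} {q : I.Req} {z : Fin I.k} {m n : ℕ}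
    (h : (back pred)^[m] q = Sum.inl z) (hmn : m ≤ n) : (back pred)^[n] q = Sum.inl z := by
  rw [← Nat.sub_add_cancel hmn, Function.iterate_add_apply, h, back_iterate_inl]

/-- The first requests that follow `q` under `pred`. -/
theorem exists_queue {pred : R → I.Req} (hinj : Function.Injective pred)
    (hreach : ∀ r, ∃ n z, (back pred)^[n] (Sum.inr r) = Sum.inl z) (n : ℕ) (q : I.Req) :
    ∃ L : List R, L.Nodup ∧ (∀ r ∈ L, ∃ j, (back pred)^[j + 1] (Sum.inr r) = q) ∧
      (∀ r ∈ L, [pred r, Sum.inr r] <:+: q :: L.map Sum.inr) ∧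
      ∀ j < n, ∀ r r', (back pred)^[j] (Sum.inr r) = Sum.inr r' → pred r' = q → r ∈ L := by
  induction n generalizing q with
  | zero => exact ⟨[], List.nodup_nil, by simp, by simp, by simp⟩
  | succ n ih =>
    by_cases h : ∃ r, pred r = q
    · obtain ⟨r₀, rfl⟩ := h
      obtain ⟨L, h1, h2, h3, h4⟩ := ih (Sum.inr r₀)
      refine ⟨r₀ :: L, List.nodup_cons.2 ⟨fun hmem => ?_, h1⟩, ?_, ?_, ?_⟩
      · -- `r₀` would precede itself, which contradicts that it leads back to a dummy request.
        obtain ⟨j, hj⟩ := h2 r₀ hmem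
        obtain ⟨m, z, hm⟩ := hreach r₀
        have h5 := Function.iterate_fixed hj m
        rw [← Function.iterate_mul] at h5
        rw [back_iterate_of_le hm (Nat.le_mul_of_pos_left m (Nat.succ_pos j))] at h5
        cases h5
      · intro r hr
        rcases List.mem_cons.1 hr with rfl | hr
        · exact ⟨0, rfl⟩
        · obtain ⟨j, hj⟩ := h2 r hr
          exact ⟨j + 1, by rw [Function.iterate_succ_apply', hj]; rfl⟩
      · intro r hr
        rcases List.mem_cons.1 hr with rfl | hr
        · exact ⟨[], L.map Sum.inr, by simp⟩
        · exact (h3 r hr).trans (List.suffix_cons _ _).isInfix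
      · intro j hj r r' hr hr'
        cases hinj hr'
        cases j with
        | zero =>
          rw [Function.iterate_zero_apply] at hr
          cases hr
          exact List.mem_cons_self
        | succ j =>
          rw [Function.iterate_succ_apply'] at hr
          rcases hy : (back pred)^[j] (Sum.inr r) with z | r''
          · rw [hy] at hr; cases hr
          · rw [hy] at hr
            exact List.mem_cons_of_mem _ (h4 j (Nat.lt_of_succ_lt_succ hj) r r'' hy hr)
    · exact ⟨[], List.nodup_nil, by simp, by simp, fun j _ r r' _ hr' => absurd ⟨r', hr'⟩ h⟩

/-- An injective predecessor assignment that leads every request back to a dummy request is a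
solution. -/
theorem isSolution_of_injective [Fintype R] {pred : R → I.Req} (hinj : Function.Injective pred)
    (hreach : ∀ r, ∃ n z, (back pred)^[n] (Sum.inr r) = Sum.inl z) : I.IsSolution pred := by
  have hlast : ∀ r, ∃ j r' z, (back pred)^[j] (Sum.inr r) = Sum.inr r' ∧ pred r' = Sum.inl z := by
    intro r
    obtain ⟨n, z, hn⟩ := hreach r
    induction n with
    | zero => cases hn
    | succ n ih =>
      rcases hy : (back pred)^[n] (Sum.inr r) with z' | r'
      · rw [Function.iterate_succ_apply', hy] at hn
        cases hn
        exact ih hy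
      · rw [Function.iterate_succ_apply', hy] at hn
        exact ⟨n, r', z, hy, hn⟩
  choose J last srv hJ hsrv using hlast
  choose queue hnodup hback hinfix hmem using fun z : Fin I.k =>
    exists_queue hinj hreach (Finset.univ.sup J + 1) (Sum.inl z)
  have hin : ∀ r, r ∈ queue (srv r) := fun r =>
    hmem (srv r) (J r) (Nat.lt_succ_of_le (Finset.le_sup (Finset.mem_univ r))) r (last r) (hJ r)
      (hsrv r)
  refine ⟨queue, hnodup, fun r => ⟨srv r, hin r, fun z hz => ?_⟩, fun r =>
    ⟨srv r, hinfix _ r (hin r)⟩⟩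
  obtain ⟨j, hj⟩ := hback _ r hz
  obtain ⟨j', hj'⟩ := hback _ r (hin r)
  have h1 := back_iterate_of_le hj (le_max_left _ (j' + 1))
  rw [back_iterate_of_le hj' (le_max_right _ _)] at h1
  exact (Sum.inl_injective h1).symm

/-! ### Predecessors are assigned at most once -/

/-- Every request has at most one successor, and the last request of a vertex that points to itself
has none yet.  The other two fields say that a request that is just being invoked is neither the
last request of a vertex nor a predecessor. -/
structure Queued (s : I.State) : Prop where
  no_successor : ∀ w q r, w ∈ s.links w → s.last w = some q → s.status r ≠ Status.scheduled q
  scheduled_unique : ∀ r r' q, s.status r = Status.scheduled q →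
    s.status r' = Status.scheduled q → r = r'
  last_ne_waiting : ∀ w r, s.last w = some (Sum.inr r) → s.status r ≠ Status.waiting
  pred_ne_waiting : ∀ r r', s.status r = Status.scheduled (Sum.inr r') →
    s.status r' ≠ Status.waiting

theorem Queued.init (I : DSMS V R) : Queued I.init := by
  refine ⟨nofun, nofun, ?_, nofun⟩
  intro w r h
  simp only [DSMS.init] at h
  split_ifs at h
  cases h

section

variable [DecidableEq V] [DecidableEq R] {s s' : I.State} {r : R} {v w z : V}

theorem Hop.status_ne_waiting_of (h : Hop s s' r v w z) {r' : R}
    (hr : s.status r' ≠ Status.waiting) : s'.status r' ≠ Status.waiting := by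
  by_cases hr' : r' = r
  · rw [hr']; exact h.status_ne_waiting
  · rwa [h.status_of_ne hr']

theorem Hop.of_scheduled (h : Hop s s' r v w z) {r' : R} {q : I.Req}
    (hr : s'.status r' = Status.scheduled q) : (r' ≠ r ∧ s.status r' = Status.scheduled q) ∨
      (r' = r ∧ z = w ∧ s.last w = some q) := by
  by_cases hr' : r' = r
  · subst hr'
    by_cases hz : z = w
    · obtain ⟨q', h1, h2⟩ := h.status_self_of_eq hz
      rw [hr] at h2
      cases h2
      exact Or.inr ⟨rfl, hz, h1⟩
    · rw [h.status_self_of_ne hz] at hr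
      cases hr
  · rw [h.status_of_ne hr'] at hr
    exact Or.inl ⟨hr', hr⟩

theorem Queued.hop (hq : Queued s) (hs : Wired s) (h : Hop s s' r v w z) : Queued s' := by
  refine ⟨?_, ?_, ?_, ?_⟩
  · intro x q r' hx hl hr'
    by_cases hxw : x = w
    · subst hxw
      rw [h.mem_links, if_pos rfl] at hx
      rcases h.source with ⟨h1, h2, h3, h4, -⟩ | ⟨τ, h1, -⟩
      · rw [h4, Function.update_self] at hl
        cases hl
        rcases h.of_scheduled hr' with ⟨-, h5⟩ | ⟨-, -, h5⟩
        · exact hq.pred_ne_waiting _ _ h5 h1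
        · exact hq.last_ne_waiting _ _ h5 h1
      · rcases hx with rfl | ⟨hx, hxz⟩
        · rcases hs.adj _ _ _ (onEdge_of_transit h1) with h3 | h3 <;> exact h3.ne rfl
        · have hleaf : I.T.IsLeaf x := by
            rcases hs.link_cases x x hx with h3 | h3 | h3
            · exact h3.2
            · exact absurd rfl h3.ne
            · exact absurd rfl h3.ne
          obtain ⟨y, hy⟩ := hs.links_leaf x hleaf
          have hz := h.choice.1
          rw [hy, Set.mem_singleton_iff] at hx hz
          exact hxz (hx.trans hz.symm)
    · rw [h.links_of_ne hxw] at hx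
      have hl' : s.last x = some q := by
        rcases h.source with ⟨-, -, -, h4, -⟩ | ⟨τ, -, h4, -⟩
        · rwa [h4, Function.update_of_ne hxw] at hl
        · rwa [h4] at hl
      rcases h.of_scheduled hr' with ⟨-, h5⟩ | ⟨-, -, h5⟩
      · exact hq.no_successor x q r' hx hl' h5
      · exact hxw ((hs.loc_last _ _ hl').symm.trans (hs.loc_last _ _ h5))
  · intro r1 r2 q h1 h2
    have key : ∀ r', z = w → s.last w = some q → s.status r' ≠ Status.scheduled q := by
      intro r' hz hl
      have hz' := h.choice.1
      rw [hz] at hz'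
      exact hq.no_successor w q r' hz' hl
    rcases h.of_scheduled h1 with ⟨-, h1⟩ | ⟨e1, hz1, h1⟩ <;>
      rcases h.of_scheduled h2 with ⟨-, h2⟩ | ⟨e2, hz2, h2⟩
    · exact hq.scheduled_unique _ _ _ h1 h2
    · exact absurd h1 (key r1 hz2 h2)
    · exact absurd h2 (key r2 hz1 h1)
    · rw [e1, e2]
  · intro x r' hl
    rcases h.source with ⟨-, -, -, h4, -⟩ | ⟨τ, -, h4, -⟩
    · by_cases hxw : x = w
      · subst hxw
        rw [h4, Function.update_self] at hl
        cases hl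
        exact h.status_ne_waiting
      · rw [h4, Function.update_of_ne hxw] at hl
        exact h.status_ne_waiting_of (hq.last_ne_waiting _ _ hl)
    · rw [h4] at hl
      exact h.status_ne_waiting_of (hq.last_ne_waiting _ _ hl)
  · intro r1 r2 h1
    rcases h.of_scheduled h1 with ⟨-, h1⟩ | ⟨-, -, h1⟩
    · exact h.status_ne_waiting_of (hq.pred_ne_waiting _ _ h1)
    · exact h.status_ne_waiting_of (hq.last_ne_waiting _ _ h1)

theorem Queued.of_reachable [Fintype V] (hs : Relation.ReflTransGen I.Step I.init s) : Queued s :=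
  (Wired.induction (P := Queued) (Queued.init I)
    (fun _ _ _ _ _ _ hs ht h => ht.hop hs h) hs).2

end

end DSMS

/-! ### Every request leads back to a server -/

namespace DSMS

variable {V R : Type*} {I : DSMS V R}

/-- A hop as an entry of the history of an execution: `pos` processes the message of `msg` that
comes from `src`, and sends it on to `dst`. -/
structure Visit (V R : Type*) where
  msg : R
  src : V
  pos : V
  dst : V

/-- Two visits send messages over the same edge, in either direction. -/
def Visit.SameEdge (a b : Visit V R) : Prop :=
  (a.pos = b.pos ∧ a.dst = b.dst) ∨ (a.pos = b.dst ∧ a.dst = b.pos)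

/-- The first `n` values of `e` are the hops of an execution that ends in `s`, in order. -/
structure History (s : I.State) (n : ℕ) (e : ℕ → Visit V R) : Prop where
  /-- A message that is sent over an edge blocks the edge until it arrives. -/
  arrives : ∀ m < n, (e m).dst ≠ (e m).pos → ∃ M, m < M ∧ M ≤ n ∧
    (∀ m', m < m' → m' < M → ¬ (e m').SameEdge (e m)) ∧
    ((M < n ∧ (e M).msg = (e m).msg ∧ (e M).src = (e m).pos ∧ (e M).pos = (e m).dst) ∨
      (M = n ∧ ∃ τ, s.status (e m).msg = Status.transit (e m).pos (e m).dst τ))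
  /-- A message that is not sent on is scheduled after an earlier request. -/
  scheduled : ∀ m < n, (e m).dst = (e m).pos → ∃ q, s.status (e m).msg = Status.scheduled q ∧
    ((∃ z, q = Sum.inl z) ∨ ∃ m' < m, q = Sum.inr (e m').msg ∧ (e m').src = (e m).pos ∧
      (e m').pos = (e m).pos)
  invoked : ∀ r, s.status r ≠ Status.waiting →
    ∃ m < n, (e m).msg = r ∧ (e m).src = I.node r ∧ (e m).pos = I.node r
  dst_ne : ∀ m < n, (e m).src ≠ (e m).pos → (e m).dst ≠ (e m).src
  dst_cases : ∀ m < n, ((e m).dst = (e m).pos ∧ I.T.IsLeaf (e m).pos) ∨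
    I.T.IsChild (e m).dst (e m).pos ∨ I.T.IsChild (e m).pos (e m).dst

section

variable [DecidableEq V] [DecidableEq R] {s s' : I.State} {r : R} {v w z : V}

theorem History.hop {n : ℕ} {e : ℕ → Visit V R} (he : History s n e) (hq : Queued s)
    (hs : Wired s) (h : Hop s s' r v w z) :
    History s' (n + 1) (Function.update e n ⟨r, v, w, z⟩) := by
  have hold : ∀ m < n, Function.update e n ⟨r, v, w, z⟩ m = e m := fun m hm =>
    Function.update_of_ne hm.ne _ _
  have hnew : Function.update e n ⟨r, v, w, z⟩ n = ⟨r, v, w, z⟩ := Function.update_self ..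
  have hsplit : ∀ m < n + 1, m < n ∨ m = n := fun m hm => lt_or_eq_of_le (Nat.le_of_lt_succ hm)
  refine ⟨?_, ?_, ?_, ?_, ?_⟩
  · intro m hm hne
    rcases hsplit m hm with hm | rfl
    · rw [hold m hm] at hne ⊢
      obtain ⟨M, h1, h2, h3, h4⟩ := he.arrives m hm hne
      have h3' : ∀ m', m < m' → m' < M →
          ¬ (Function.update e n ⟨r, v, w, z⟩ m').SameEdge (e m) := by
        intro m' hm1 hm2
        rw [hold m' (hm2.trans_le h2)]
        exact h3 m' hm1 hm2
      rcases h4 with ⟨h4, h5⟩ | ⟨rfl, τ, hτ⟩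
      · exact ⟨M, h1, h2.trans (Nat.le_succ n), h3',
          Or.inl ⟨h4.trans (Nat.lt_succ_self n), by rwa [hold M h4]⟩⟩
      · by_cases hr : (e m).msg = r
        · rw [hr] at hτ
          rcases h.source with ⟨h5, -⟩ | ⟨τ', h5, -⟩
          · rw [hτ] at h5; cases h5
          · rw [hτ] at h5
            simp only [Status.transit.injEq] at h5
            refine ⟨M, h1, Nat.le_succ M, h3', Or.inl ⟨Nat.lt_succ_self M, ?_⟩⟩
            rw [hnew]
            exact ⟨hr.symm, h5.1.symm, h5.2.1.symm⟩
        · refine ⟨M + 1, h1.trans (Nat.lt_succ_self M), le_rfl, ?_,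
            Or.inr ⟨rfl, τ, by rw [h.status_of_ne hr]; exact hτ⟩⟩
          intro m' hm1 hm2
          rcases hsplit m' hm2 with hm2 | rfl
          · exact h3' m' hm1 hm2
          · rw [hnew]
            have h5 := onEdge_of_transit hτ
            rintro (⟨h6, h7⟩ | ⟨h6, h7⟩)
            · refine hs.not_mem_links _ _ _ h5 ?_
              rw [← h6, ← h7]
              exact h.choice.1
            · refine hs.not_mem_links _ _ _ h5.symm ?_
              rw [← h6, ← h7]
              exact h.choice.1
    · rw [hnew] at hne ⊢
      refine ⟨m + 1, Nat.lt_succ_self m, le_rfl, fun m' h1 h2 => by omega,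
        Or.inr ⟨rfl, _, h.status_self_of_ne hne⟩⟩
  · intro m hm heq
    rcases hsplit m hm with hm | rfl
    · rw [hold m hm] at heq ⊢
      obtain ⟨q, h1, h2⟩ := he.scheduled m hm heq
      have hr : (e m).msg ≠ r := by
        intro hr
        rw [hr] at h1
        rcases h.source with ⟨h5, -⟩ | ⟨τ', h5, -⟩ <;> rw [h5] at h1 <;> cases h1
      refine ⟨q, by rwa [h.status_of_ne hr], h2.imp_right ?_⟩
      rintro ⟨m', hm', h3⟩
      exact ⟨m', hm', by rwa [hold m' (hm'.trans hm)]⟩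
    · rw [hnew] at heq ⊢
      obtain ⟨q, h1, h2⟩ := h.status_self_of_eq heq
      refine ⟨q, h2, ?_⟩
      rcases q with z' | r'
      · exact Or.inl ⟨z', rfl⟩
      · right
        obtain ⟨m', h3, h4, h5, h6⟩ := he.invoked r' (hq.last_ne_waiting _ _ h1)
        have h7 : I.node r' = w := hs.loc_last _ _ h1
        refine ⟨m', h3, ?_⟩
        rw [hold m' h3, h4, h5, h6]
        exact ⟨rfl, h7, h7⟩
  · intro r' hr'
    by_cases hr : r' = r ∧ s.status r' = Status.waiting
    · obtain ⟨rfl, hr⟩ := hr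
      refine ⟨n, Nat.lt_succ_self n, ?_⟩
      rw [hnew]
      rcases h.source with ⟨-, h1, h2, -⟩ | ⟨τ, h1, -⟩
      · exact ⟨rfl, h1.trans h2, h2⟩
      · rw [hr] at h1; cases h1
    · have hr2 : s.status r' ≠ Status.waiting := by
        intro h1
        refine hr ⟨?_, h1⟩
        by_contra hne
        rw [h.status_of_ne hne] at hr'
        exact hr' h1
      obtain ⟨m, hm, h1⟩ := he.invoked r' hr2
      exact ⟨m, hm.trans (Nat.lt_succ_self n), by rwa [hold m hm]⟩
  · intro m hm
    rcases hsplit m hm with hm | rfl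
    · rw [hold m hm]; exact he.dst_ne m hm
    · rw [hnew]; exact hs.target_ne h
  · intro m hm
    rcases hsplit m hm with hm | rfl
    · rw [hold m hm]; exact he.dst_cases m hm
    · rw [hnew]; exact hs.target_adj h

theorem exists_history [Fintype V] [Nonempty R] (hs : Relation.ReflTransGen I.Step I.init s) :
    ∃ n e, History s n e := by
  induction hs with
  | refl =>
    obtain ⟨r⟩ := ‹Nonempty R›
    exact ⟨0, fun _ => ⟨r, I.T.root, I.T.root, I.T.root⟩, by simp, by simp,
      fun r hr => absurd rfl hr, by simp, by simp⟩
  | tail hs hstep ih =>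
    obtain ⟨n, e, he⟩ := ih
    obtain ⟨r, v, w, z, h⟩ := hstep.exists_hop
    exact ⟨_, _, he.hop (Queued.of_reachable hs) (Wired.of_reachable hs) h⟩

end

/-- Going back from `r` along `pred`, one reaches `r'`. -/
def LeadsTo (pred : R → I.Req) (r r' : R) : Prop := ∃ n, (back pred)^[n] (Sum.inr r) = Sum.inr r'

theorem LeadsTo.trans {pred : R → I.Req} {a b c : R} (h : LeadsTo pred a b)
    (h' : LeadsTo pred b c) : LeadsTo pred a c := by
  obtain ⟨n, hn⟩ := h
  obtain ⟨m, hm⟩ := h'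
  exact ⟨m + n, by rw [Function.iterate_add_apply, hn, hm]⟩

/-- Going back from `r` along `pred`, one reaches a dummy request. -/
def LeadsToServer (pred : R → I.Req) (r : R) : Prop :=
  ∃ n z, (back pred)^[n] (Sum.inr r) = Sum.inl z

theorem LeadsTo.leadsToServer {pred : R → I.Req} {a b : R} (h : LeadsTo pred a b)
    (h' : LeadsToServer pred b) : LeadsToServer pred a := by
  obtain ⟨n, hn⟩ := h
  obtain ⟨m, z, hm⟩ := h'
  exact ⟨m + n, z, by rw [Function.iterate_add_apply, hn, hm]⟩

section

variable {s : I.State} {n : ℕ} {e : ℕ → Visit V R} {pred : R → I.Req}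

theorem History.exists_next (he : History s n e)
    (hpred : ∀ r, s.status r = Status.scheduled (pred r)) {m : ℕ} (hm : m < n)
    (hne : (e m).dst ≠ (e m).pos) : ∃ M, m < M ∧ M < n ∧
      (∀ m', m < m' → m' < M → ¬ (e m').SameEdge (e m)) ∧
      (e M).msg = (e m).msg ∧ (e M).src = (e m).pos ∧ (e M).pos = (e m).dst := by
  obtain ⟨M, h1, -, h3, h4 | ⟨-, τ, hτ⟩⟩ := he.arrives m hm hne
  · exact ⟨M, h1, h4.1, h3, h4.2⟩
  · rw [hpred] at hτ; cases hτ

/-- The key to the absence of cycles: if a message is sent down or scheduled at a vertex, then its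
predecessors lead to a server or to a request whose message has left the same vertex upwards
before. -/
theorem History.leadsTo_up (he : History s n e)
    (hpred : ∀ r, s.status r = Status.scheduled (pred r)) {m : ℕ} (hm : m < n)
    (hup : ¬ I.T.IsChild (e m).pos (e m).dst) : LeadsToServer pred (e m).msg ∨
      ∃ m' < m, LeadsTo pred (e m).msg (e m').msg ∧ (e m').pos = (e m).pos ∧
        I.T.IsChild (e m').pos (e m').dst := by
  -- Induction on the height of the vertex, then on the time.
  induction hh : I.T.height (e m).pos using Nat.strong_induction_on generalizing m with
  | _ H ihH =>
  induction m using Nat.strong_induction_on with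
  | _ m ihm =>
  have finish : ∀ m' < m, LeadsTo pred (e m).msg (e m').msg → (e m').pos = (e m).pos →
      LeadsToServer pred (e m).msg ∨ ∃ m' < m, LeadsTo pred (e m).msg (e m').msg ∧
        (e m').pos = (e m).pos ∧ I.T.IsChild (e m').pos (e m').dst := by
    intro m' hm' hl hpos
    by_cases hup' : I.T.IsChild (e m').pos (e m').dst
    · exact Or.inr ⟨m', hm', hl, hpos, hup'⟩
    · rcases ihm m' hm' (hm'.trans hm) hup' (by rw [hpos, hh]) with h1 | ⟨m2, h1, h2, h3, h4⟩
      · exact Or.inl (hl.leadsToServer h1)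
      · exact Or.inr ⟨m2, h1.trans hm', hl.trans h2, h3.trans hpos, h4⟩
  by_cases heq : (e m).dst = (e m).pos
  · obtain ⟨q, h1, h2⟩ := he.scheduled m hm heq
    rw [hpred] at h1
    simp only [Status.scheduled.injEq] at h1
    rcases h2 with ⟨z, rfl⟩ | ⟨m', hm', rfl, -, h3⟩
    · exact Or.inl ⟨1, z, h1⟩
    · exact finish m' hm' ⟨1, h1⟩ h3
  · have hdown : I.T.IsChild (e m).dst (e m).pos :=
      ((he.dst_cases m hm).resolve_left fun h => heq h.1).resolve_right hup
    obtain ⟨M, hmM, hMn, hfree, hmsg, hsrc, hpos⟩ := he.exists_next hpred hm heq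
    have hMup : ¬ I.T.IsChild (e M).pos (e M).dst := by
      intro h1
      refine he.dst_ne M hMn ?_ ?_
      · rw [hsrc, hpos]; exact hdown.ne.symm
      · rw [hpos] at h1
        rw [hsrc]; exact h1.unique hdown
    have hlt : I.T.height (e M).pos < H := by
      have := hdown.height_eq
      rw [hpos]; omega
    rcases ihH _ hlt hMn hMup rfl with h1 | ⟨f, hfM, hf1, hf2, hf3⟩
    · exact Or.inl (hmsg ▸ h1)
    rw [hmsg] at hf1
    rw [hpos] at hf2
    have hfdst : (e f).dst = (e m).pos := (hf2 ▸ hf3).unique hdown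
    have hfn := hfM.trans hMn
    -- The message that has left the child arrives here before step `m`, as the edge is not shared.
    obtain ⟨F, hfF, hFn, hfree', hmsg', hsrc', hpos'⟩ := he.exists_next hpred hfn hf3.ne.symm
    have hfm : f < m := by
      rcases lt_trichotomy f m with h1 | rfl | h1
      · exact h1
      · exact absurd hf2.symm hdown.ne
      · exact absurd (Or.inr ⟨hf2, hfdst⟩) (hfree f h1 hfM)
    have hFm : F < m := by
      rcases lt_trichotomy F m with h1 | rfl | h1
      · exact h1
      · refine absurd (hsrc'.trans hf2).symm (he.dst_ne F hFn ?_)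
        rw [hsrc', hf2]; exact hdown.ne
      · exact absurd (Or.inr ⟨hfdst.symm, hf2.symm⟩) (hfree' m hfm h1)
    exact finish F hFm (hmsg' ▸ hf1) (hpos'.trans hfdst)

/-- All predecessors lead to a server, by induction from the root downwards. -/
theorem History.leadsToServer [Fintype V] (he : History s n e)
    (hpred : ∀ r, s.status r = Status.scheduled (pred r)) {m : ℕ} (hm : m < n) :
    LeadsToServer pred (e m).msg := by
  induction hd : I.T.depth - I.T.height (e m).pos using Nat.strong_induction_on generalizing m with
  | _ d ih =>
  have up : ∀ m' < n, (e m').pos = (e m).pos → I.T.IsChild (e m').pos (e m').dst →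
      LeadsToServer pred (e m').msg := by
    intro m' hm' hpos hup
    obtain ⟨M, -, hMn, -, hmsg, -, hMpos⟩ := he.exists_next hpred hm' hup.ne.symm
    rw [← hmsg]
    refine ih _ ?_ hMn rfl
    rw [hMpos, hup.height_eq, hpos]
    have := hup.height_lt
    rw [hpos] at this
    omega
  by_cases hup : I.T.IsChild (e m).pos (e m).dst
  · exact up m hm rfl hup
  · rcases he.leadsTo_up hpred hm hup with h1 | ⟨m', hm', hl, hpos, hup'⟩
    · exact h1
    · exact hl.leadsToServer (up m' (hm'.trans hm) hpos hup')

theorem isSolution_of_reachable [Fintype V] [DecidableEq V] [Fintype R] [DecidableEq R]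
    (hs : Relation.ReflTransGen I.Step I.init s)
    (hpred : ∀ r, s.status r = Status.scheduled (pred r)) : I.IsSolution pred := by
  refine isSolution_of_injective (fun r r' h => ?_) fun r => ?_
  · exact (Queued.of_reachable hs).scheduled_unique r r' (pred r) (hpred r) (h ▸ hpred r')
  · have : Nonempty R := ⟨r⟩
    obtain ⟨n, e, he⟩ := exists_history hs
    obtain ⟨m, hm, rfl, -⟩ := he.invoked r (by rw [hpred]; exact nofun)
    exact he.leadsToServer hpred hm

end

end DSMS

theorem theorem3 {V R : Type*} [Fintype V] [DecidableEq V] [Fintype R] [DecidableEq R]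
    (I : DSMS V R) :
    ¬ I.HasInfiniteExecution ∧
    ∀ s : I.State, I.IsFinal s →
      (∃ pred : R → I.Req, (∀ r, s.status r = DSMS.Status.scheduled (pred r)) ∧
        I.IsSolution pred) ∧
      (s.cost : EReal) ≤ I.offlineOptimum := by
  refine ⟨DSMS.not_hasInfiniteExecution I, fun s hs => ?_⟩
  have hsched := hs.exists_scheduled
  refine ⟨?_, (EReal.coe_le_coe_iff.2 (DSMS.cost_le hs.1 hsched)).trans
    DSMS.sum_needy_le_offlineOptimum⟩
  choose pred hpred using hsched
  exact ⟨pred, hpred, DSMS.isSolution_of_reachable hs.1 hpred⟩
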